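/- Let $S^1=\mathbb R/\mathbb Z$, let $\pi:\mathbb R^2\to S^1\times\mathbb R$ and $p:\mathbb R^2\to\mathbb T^2=\mathbb R^2/\mathbb Z^2$ be the covering maps, and write points of the plane as $(\phi,I)$. Let $TQ$ be the set of $C^1$ diffeomorphisms $T=(T_\phi,T_I)$ of $\mathbb R^2$ that are lifts of $C^1$ diffeomorphisms of $S^1\times\mathbb R$, with $\partial_I T_\phi>0$ everywhere, with $T_\phi(\phi,I)\to\pm\infty$ and $T_I(\phi,I)\to\pm\infty$ as $I\to\pm\infty$, and with $$T_I(\phi+1,I)=T_I(\phi,I),\quad T_I(\phi,I+1)=T_I(\phi,I)+1,\quad T_\phi(\phi+1,I)=T_\phi(\phi,I)+1,\quad T_\phi(\phi,I+1)=T_\phi(\phi,I)+1 .$$ Such a $T$ induces a map $\widehat T$ of $S^1\times\mathbb R$ and a map $\overline T$ of $\mathbb T^2$. Let $\mu$ be a measure on $S^1\times\mathbb R$ that is positive on nonempty open sets and absolutely continuous with respect to Lebesgue measure. The map $\widehat T$ is called $\mu$-exact if $\mu$ is $\widehat T$-invariant and $\mu(\widehat T(A)\setminus A)=\mu(A\setminus\widehat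 T(A))$ for every open set $A\subset S^1\times\mathbb R$ that is homeomorphic to $S^1\times\mathbb R$, contains $S^1\times(-\infty,a)$ for some $a\in\mathbb R$, and is contained in $S^1\times(-\infty,b)$ for some $b\in\mathbb R$. A periodic orbit $O\subset\mathbb T^2$ of $\overline T$ has vertical rotation number $\omega$ if for every $z\in p^{-1}(O)$ the second coordinate $I_n$ of $T^n(z)$ tends to $+\infty$ or to $-\infty$ as $n\to\infty$ and $\lim_{n\to\infty}(I_n-I_0)/n=\omega$. **Theorem.** Let $T\in TQ$ be such that $\widehat T$ is $\mu$-exact for some such measure $\mu$. Let $k\in\mathbb Z$ and $N\ge 1$, and suppose that $\overline T$ has a periodic orbit with vertical rotation number $k/N$. Then for all integers $k'\neq 0$ and $N'\ge 1$ with $0<|k'/N'|<|k/N|$ and $kk'>0$, the map $\overline T$ has at least two distinct periodic orbits with vertical rotation number $k'/N'$. -/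

import Mathlib

open MeasureTheory Filter Topology

noncomputable section

namespace TwistMap

/-- The universal cover `ℝ²`, with coordinates `(φ, I)`. -/
abbrev Plane : Type := ℝ × ℝ

/-- The cylinder `S¹ × ℝ`, with `S¹ = ℝ/ℤ`. -/
abbrev Cylinder : Type := UnitAddCircle × ℝ

/-- The torus `ℝ²/ℤ²`. -/
abbrev Torus : Type := UnitAddCircle × UnitAddCircle

/-- The covering map of the cylinder, `(φ, I) ↦ (φ mod 1, I)`. -/
def toCylinder (z : Plane) : Cylinder := ((z.1 : UnitAddCircle), z.2)

/-- The covering map of the torus. -/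
def toTorus (z : Plane) : Torus := ((z.1 : UnitAddCircle), (z.2 : UnitAddCircle))

/-- `f` is a `C¹` diffeomorphism of the plane. -/
def IsC1Diffeo (f : Plane → Plane) : Prop :=
  ContDiff ℝ 1 f ∧ ∃ g : Plane → Plane,
    ContDiff ℝ 1 g ∧ Function.LeftInverse g f ∧ Function.RightInverse g f

/-- The class `D_r¹(ℝ²)` of lifts of right twist diffeomorphisms of the cylinder. -/
structure IsTwistLift (f : Plane → Plane) : Prop where
  diffeo : IsC1Diffeo f
  vert_top : ∀ φ : ℝ, Tendsto (fun I : ℝ => (f (φ, I)).2) atTop atTop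
  vert_bot : ∀ φ : ℝ, Tendsto (fun I : ℝ => (f (φ, I)).2) atBot atBot
  twist : ∀ φ I : ℝ, 0 < deriv (fun t : ℝ => (f (φ, t)).1) I
  horiz_top : ∀ φ : ℝ, Tendsto (fun I : ℝ => (f (φ, I)).1) atTop atTop
  horiz_bot : ∀ φ : ℝ, Tendsto (fun I : ℝ => (f (φ, I)).1) atBot atBot
  /-- `f` covers a bijection of the cylinder that is a homeomorphism; since `toCylinder` is a local
  diffeomorphism and `f` is a `C¹` diffeomorphism, the covered map is then a `C¹` diffeomorphism. -/
  lift : ∃ F : Cylinder ≃ₜ Cylinder, ∀ z : Plane, F (toCylinder z) = toCylinder (f z)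

/-- The class `TQ`. -/
structure IsTQ (T : Plane → Plane) : Prop extends IsTwistLift T where
  vert_add_fst : ∀ φ I : ℝ, (T (φ + 1, I)).2 = (T (φ, I)).2
  vert_add_snd : ∀ φ I : ℝ, (T (φ, I + 1)).2 = (T (φ, I)).2 + 1
  horiz_add_fst : ∀ φ I : ℝ, (T (φ + 1, I)).1 = (T (φ, I)).1 + 1
  horiz_add_snd : ∀ φ I : ℝ, (T (φ, I + 1)).1 = (T (φ, I)).1 + 1

/-- The representative in `[0, 1)` of a point of the circle. -/
def rep (x : UnitAddCircle) : ℝ := (AddCircle.equivIco 1 0 x : ℝ)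

/-- The map of the cylinder induced by `T`; see `IsTQ.cylinderMap_toCylinder`. -/
def cylinderMap (T : Plane → Plane) (x : Cylinder) : Cylinder := toCylinder (T (rep x.1, x.2))

/-- The map of the torus induced by `T`; see `IsTQ.torusMap_toTorus`. -/
def torusMap (T : Plane → Plane) (x : Torus) : Torus := toTorus (T (rep x.1, rep x.2))

theorem rep_coe (t : ℝ) : ∃ n : ℤ, rep (t : UnitAddCircle) = t + n := by
  have h : ((rep (t : UnitAddCircle) : ℝ) : UnitAddCircle) = (t : UnitAddCircle) :=
    AddCircle.coe_equivIco
  rw [← sub_eq_zero, ← AddCircle.coe_sub, AddCircle.coe_eq_zero_iff] at h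
  obtain ⟨n, hn⟩ := h
  refine ⟨n, ?_⟩
  simp at hn
  linarith

theorem IsTQ.apply_add_int {T : Plane → Plane} (hT : IsTQ T) (φ I : ℝ) (i j : ℤ) :
    T (φ + i, I + j) = ((T (φ, I)).1 + i + j, (T (φ, I)).2 + j) := by
  have h1 : ∀ (i : ℤ) (φ I : ℝ), T (φ + i, I) = ((T (φ, I)).1 + i, (T (φ, I)).2) := by
    intro i
    induction i using Int.induction_on with
    | zero => intro φ I; simp
    | succ n ih =>
      intro φ I
      have e : φ + ((n + 1 : ℤ) : ℝ) = (φ + (n : ℤ)) + 1 := by push_cast; ring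
      rw [e]
      ext
      · rw [hT.horiz_add_fst, ih]; push_cast; ring
      · rw [hT.vert_add_fst, ih]
    | pred n ih =>
      intro φ I
      have e : φ + ((-(n : ℤ) : ℤ) : ℝ) = (φ + ((-(n : ℤ) - 1 : ℤ) : ℝ)) + 1 := by
        push_cast; ring
      have h := ih φ I
      rw [e] at h
      ext
      · have := hT.horiz_add_fst (φ + ((-(n : ℤ) - 1 : ℤ) : ℝ)) I
        rw [h] at this; push_cast at this ⊢; linarith
      · have := hT.vert_add_fst (φ + ((-(n : ℤ) - 1 : ℤ) : ℝ)) I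
        rw [h] at this; exact this.symm
  have h2 : ∀ (j : ℤ) (φ I : ℝ), T (φ, I + j) = ((T (φ, I)).1 + j, (T (φ, I)).2 + j) := by
    intro j
    induction j using Int.induction_on with
    | zero => intro φ I; simp
    | succ n ih =>
      intro φ I
      have e : I + ((n + 1 : ℤ) : ℝ) = (I + (n : ℤ)) + 1 := by push_cast; ring
      rw [e]
      ext
      · rw [hT.horiz_add_snd, ih]; push_cast; ring
      · rw [hT.vert_add_snd, ih]; push_cast; ring
    | pred n ih =>
      intro φ I
      have e : I + ((-(n : ℤ) : ℤ) : ℝ) = (I + ((-(n : ℤ) - 1 : ℤ) : ℝ)) + 1 := by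
        push_cast; ring
      have h := ih φ I
      rw [e] at h
      ext
      · have := hT.horiz_add_snd φ (I + ((-(n : ℤ) - 1 : ℤ) : ℝ))
        rw [h] at this; push_cast at this ⊢; linarith
      · have := hT.vert_add_snd φ (I + ((-(n : ℤ) - 1 : ℤ) : ℝ))
        rw [h] at this; push_cast at this ⊢; linarith
  rw [h2, h1]

theorem coe_add_int (t : ℝ) (n : ℤ) : ((t + n : ℝ) : UnitAddCircle) = (t : UnitAddCircle) := by
  rw [← sub_eq_zero, ← AddCircle.coe_sub, AddCircle.coe_eq_zero_iff]
  exact ⟨n, by simp⟩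

theorem IsTQ.cylinderMap_toCylinder {T : Plane → Plane} (hT : IsTQ T) (z : Plane) :
    cylinderMap T (toCylinder z) = toCylinder (T z) := by
  obtain ⟨n, hn⟩ := rep_coe z.1
  have h := hT.apply_add_int z.1 z.2 n 0
  simp only [Int.cast_zero, add_zero] at h
  simp only [cylinderMap, toCylinder, hn, h, coe_add_int]

theorem IsTQ.torusMap_toTorus {T : Plane → Plane} (hT : IsTQ T) (z : Plane) :
    torusMap T (toTorus z) = toTorus (T z) := by
  obtain ⟨n, hn⟩ := rep_coe z.1
  obtain ⟨m, hm⟩ := rep_coe z.2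
  simp only [torusMap, toTorus, hn, hm, hT.apply_add_int, coe_add_int]

/-- `F` is `μ`-exact: `μ` is positive on open sets, absolutely continuous with respect to Lebesgue
measure and `F`-invariant, and the net `μ`-flux through every essential boundary vanishes. The sets
`A` are the open sets homeomorphic to the cylinder that are a neighbourhood of the lower end and
are bounded above. -/
structure IsExact (μ : Measure Cylinder) (F : Cylinder → Cylinder) : Prop where
  pos : ∀ U : Set Cylinder, IsOpen U → U.Nonempty → 0 < μ U
  ac : μ ≪ volume
  invariant : MeasurePreserving F μ μ
  flux : ∀ A : Set Cylinder, IsOpen A → Nonempty (A ≃ₜ Cylinder) →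
    (∃ a b : ℝ, (∀ x : Cylinder, x.2 < a → x ∈ A) ∧ (∀ x ∈ A, x.2 < b)) →
    μ ((F '' A) \ A) = μ (A \ (F '' A))

/-- `O` is the orbit of a periodic point of `F`. -/
def IsPeriodicOrbit {X : Type*} (F : X → X) (O : Set X) : Prop :=
  ∃ x : X, (∃ n : ℕ, 0 < n ∧ F^[n] x = x) ∧ O = Set.range (fun m : ℕ => F^[m] x)

/-- The set `O` of points of the torus has vertical rotation number `ω`: the lifted orbits of its
points go up or down to infinity, with asymptotic vertical speed `ω`. -/
def HasVerticalRotationNumber (T : Plane → Plane) (O : Set Torus) (ω : ℝ) : Prop :=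
  ∀ z : Plane, toTorus z ∈ O →
    (Tendsto (fun n : ℕ => (T^[n] z).2) atTop atTop ∨
      Tendsto (fun n : ℕ => (T^[n] z).2) atTop atBot) ∧
    Tendsto (fun n : ℕ => ((T^[n] z).2 - z.2) / (n : ℝ)) atTop (𝓝 ω)

end TwistMap

end

/-!
A map `T` in `TQ` is generated by a monotone recurrence: the point above `a` that is sent above `b`
has momentum `g a b` and its image has momentum `h a b`, and the first coordinates of the orbits of
`T` are the solutions of `g xᵢ xᵢ₊₁ = h xᵢ₋₁ xᵢ`. Up to integer translations, an orbit with
`T^N z = z + (0, k)` is a cyclic solution of this recurrence with a forcing `k` at one site.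

An orbit whose vertical speed is larger (smaller) than `k / N` becomes, after subtraction of a
broken line of integers, a solution of the forced recurrence on `ℤ` with quadratic growth to `+∞`
(to `-∞`); its minima (maxima) over the residue classes modulo `N` form a strict cyclic super-
(sub-) solution. Relaxing all sites of a cyclic sequence at once is a monotone map `P` which
commutes with integer translations and is eventually strongly monotone. The supersolution `h`
moves down under `P` and the subsolution moves up. A fixed point lies between two translates of
these; a second one, not a translate of the first, lies between some translate of the subsolution
and `h` or else, by Brouwer's theorem, on the boundary of the set of sequences whose orbit gets
below `h`.

Exactness provides an orbit of speed zero: if `g a a ≠ h a a` for all `a`, the map sends the region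
below the graph of `a ↦ g a a` onto the one below the disjoint graph of `a ↦ h a a`, and the flux
does not vanish.
-/

section Brouwer

theorem inter_frontier_nonempty_of_isPreconnected {X : Type*} [TopologicalSpace X] {s t : Set X}
    (hs : IsPreconnected s) (hst : (s ∩ t).Nonempty) (hst' : (s ∩ tᶜ).Nonempty) :
    (s ∩ frontier t).Nonempty := by
  by_contra! h
  have hcover : s ⊆ interior t ∪ interior tᶜ := fun x hx => by
    by_contra hxt
    simp only [interior_compl, Set.mem_union, Set.mem_compl_iff, not_or, not_not] at hxt
    exact (h ▸ ⟨hx, hxt.2, hxt.1⟩ : x ∈ (∅ : Set X))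
  obtain ⟨x, hx, hxt⟩ := hst
  obtain ⟨y, hy, hyt⟩ := hst'
  have hxi : x ∈ interior t :=
    (hcover hx).resolve_right fun hxc => interior_subset hxc hxt
  have hyi : y ∈ interior tᶜ :=
    (hcover hy).resolve_left fun hyc => hyt (interior_subset hyc)
  obtain ⟨z, -, hz, hzc⟩ :=
    hs _ _ isOpen_interior isOpen_interior hcover ⟨x, hx, hxi⟩ ⟨y, hy, hyi⟩
  exact interior_subset hzc (interior_subset hz)

theorem lipschitzWith_indicator {E F : Type*} [NormedAddCommGroup E] [NormedSpace ℝ E]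
    [SeminormedAddCommGroup F] {K : NNReal} {f : E → F} {s : Set E} (hs : IsClosed s)
    (hf : LipschitzOnWith K f s) (hf₀ : ∀ x ∈ frontier s, f x = 0) :
    LipschitzWith K (s.indicator f) := by
  have hcross : ∀ x ∈ s, ∀ y ∉ s, dist (f x) 0 ≤ K * dist x y := by
    intro x hx y hy
    obtain ⟨z, hz, hzs⟩ := inter_frontier_nonempty_of_isPreconnected (t := s)
      (convex_segment (𝕜 := ℝ) x y).isPreconnected
      ⟨x, left_mem_segment ℝ x y, hx⟩ ⟨y, right_mem_segment ℝ x y, hy⟩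
    have hxz : dist x z ≤ dist x y := by
      linarith [dist_add_dist_of_mem_segment hz, dist_nonneg (x := z) (y := y)]
    calc dist (f x) 0 = dist (f x) (f z) := by rw [hf₀ z hzs]
      _ ≤ K * dist x z := hf.dist_le_mul x hx z (hs.frontier_subset hzs)
      _ ≤ K * dist x y := by gcongr
  refine LipschitzWith.of_dist_le_mul fun x y => ?_
  by_cases hx : x ∈ s <;> by_cases hy : y ∈ s
  · simpa [hx, hy] using hf.dist_le_mul x hx y hy
  · simpa [hx, hy] using hcross x hx y hy
  · simpa [hx, hy, dist_comm] using hcross y hy x hx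
  · simp only [Set.indicator_of_notMem hx, Set.indicator_of_notMem hy, dist_self]
    positivity

theorem bijective_add_of_lipschitzWith_lt_one {E : Type*} [NormedAddCommGroup E] [CompleteSpace E]
    {K : NNReal} (hK : K < 1) {h : E → E} (hh : LipschitzWith K h) :
    Function.Bijective fun x => x + h x := by
  have hcontr (y : E) : ContractingWith K fun x => y - h x :=
    ⟨hK, LipschitzWith.of_dist_le_mul fun a b => by
      simpa only [dist_sub_left] using hh.dist_le_mul a b⟩
  refine ⟨fun a b hab => ?_, fun y => ?_⟩
  · have ha : Function.IsFixedPt (fun x => (a + h a) - h x) a := add_sub_cancel_right _ _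
    have hb : Function.IsFixedPt (fun x => (a + h a) - h x) b := sub_eq_iff_eq_add.2 hab
    exact (hcontr _).fixedPoint_unique' ha hb
  · exact ⟨_, (sub_eq_iff_eq_add.1 (hcontr y).fixedPoint_isFixedPt.eq).symm⟩

theorem image_eq_self_of_bijective_of_eqOn_compl {X : Type*} {f : X → X} {s : Set X}
    (hf : Function.Bijective f) (hs : ∀ x ∉ s, f x = x) : f '' s = s := by
  have hcompl : f '' sᶜ = sᶜ := by
    exact (Set.image_congr hs).trans (Set.image_id' _)
  rw [← compl_inj_iff, ← Set.image_compl_eq hf, hcompl]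

section Polynomial

open Polynomial

theorem exists_natDegree_le_eval_eq_det_id_add_smul {E : Type*} [NormedAddCommGroup E]
    [NormedSpace ℝ E] [FiniteDimensional ℝ E] (A : E →L[ℝ] E) :
    ∃ p : ℝ[X], p.natDegree ≤ Module.finrank ℝ E ∧
      ∀ t : ℝ, p.eval t = (ContinuousLinearMap.id ℝ E + t • A).det := by
  set b := Module.finBasis ℝ E
  set M := LinearMap.toMatrix b b A
  refine ⟨Matrix.det ((X : ℝ[X]) • M.map C + (1 : Matrix _ _ ℝ).map C), ?_, fun t => ?_⟩
  · simpa using natDegree_det_X_add_C_le M 1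
  · rw [← coe_evalRingHom, RingHom.map_det, ContinuousLinearMap.det, ← LinearMap.det_toMatrix b]
    congr 1
    ext i j
    by_cases hij : i = j <;> simp [M, hij] <;> ring

theorem exists_eval_eq_integral_eval {α : Type*} [MeasurableSpace α] {μ : Measure α}
    {p : α → ℝ[X]} {d : ℕ} (hp : ∀ x, (p x).natDegree ≤ d)
    (hint : ∀ t, Integrable (fun x => (p x).eval t) μ) :
    ∃ q : ℝ[X], ∀ t, q.eval t = ∫ x, (p x).eval t ∂μ := by
  set s := Finset.range (d + 1)
  have hcast : Set.InjOn (Nat.cast : ℕ → ℝ) s := Nat.cast_injective.injOn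
  have hinterp (x : α) : p x = Lagrange.interpolate s Nat.cast fun j => (p x).eval (j : ℝ) := by
    refine Lagrange.eq_interpolate hcast ?_
    rw [Finset.card_range, Nat.cast_add_one]
    exact degree_le_natDegree.trans_lt (by exact_mod_cast Nat.lt_succ_of_le (hp x))
  refine ⟨Lagrange.interpolate s Nat.cast fun j => ∫ x, (p x).eval (j : ℝ) ∂μ, fun t => ?_⟩
  have heval (x : α) : (p x).eval t =
      ∑ j ∈ s, (p x).eval (j : ℝ) * (Lagrange.basis s Nat.cast j).eval t := by
    conv_lhs => rw [hinterp x, Lagrange.interpolate_apply, eval_finsetSum]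
    simp only [eval_mul, eval_C]
  rw [integral_congr_ae (Eventually.of_forall heval),
    integral_finsetSum _ fun (j : ℕ) _ => (hint j).mul_const _,
    Lagrange.interpolate_apply, eval_finsetSum]
  simp only [eval_mul, eval_C, integral_mul_const]

theorem exists_eval_eq_integral_det_id_add_smul {α E : Type*} [MeasurableSpace α] {μ : Measure α}
    [NormedAddCommGroup E] [NormedSpace ℝ E] [FiniteDimensional ℝ E] {A : α → E →L[ℝ] E}
    (hint : ∀ t : ℝ, Integrable (fun x => (ContinuousLinearMap.id ℝ E + t • A x).det) μ) :
    ∃ q : ℝ[X], ∀ t, q.eval t = ∫ x, (ContinuousLinearMap.id ℝ E + t • A x).det ∂μ := by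
  choose p hp hpA using fun x => exists_natDegree_le_eval_eq_det_id_add_smul (A x)
  simp only [← hpA] at hint ⊢
  exact exists_eval_eq_integral_eval hp hint

end Polynomial

theorem eventually_det_id_add_smul_pos {E ι : Type*} [NormedAddCommGroup E] [NormedSpace ℝ E]
    {s : Set ι} {A : ι → E →L[ℝ] E} {K : ℝ}
    (hA : ∀ x ∈ s, ‖A x‖ ≤ K) :
    ∀ᶠ t : ℝ in 𝓝 0, ∀ x ∈ s, 0 < (ContinuousLinearMap.id ℝ E + t • A x).det := by
  have hpos : ∀ᶠ B in 𝓝 (ContinuousLinearMap.id ℝ E), 0 < B.det :=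
    (ContinuousLinearMap.continuous_det (E := E) (𝕜 := ℝ)).continuousAt.eventually
      (lt_mem_nhds (by simp [ContinuousLinearMap.det]))
  obtain ⟨η, hη, hdet⟩ := Metric.eventually_nhds_iff.1 hpos
  have hsmall : ∀ᶠ t : ℝ in 𝓝 0, |t| * K < η :=
    (Continuous.tendsto' (by fun_prop) 0 0 (by simp)).eventually_lt_const hη
  filter_upwards [hsmall] with t ht x hx
  refine hdet ?_
  rw [dist_eq_norm, add_sub_cancel_left, norm_smul, Real.norm_eq_abs]
  exact (mul_le_mul_of_nonneg_left (hA x hx) (abs_nonneg t)).trans_lt ht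

section FiniteDimensional

variable {E : Type*} [NormedAddCommGroup E] [NormedSpace ℝ E] [FiniteDimensional ℝ E]
  [MeasurableSpace E] [BorelSpace E] (μ : Measure E) [μ.IsAddHaarMeasure]

theorem eventually_integral_det_id_add_smul_eq {s : Set E} (hs : MeasurableSet s) {h : E → E}
    {h' : E → E →L[ℝ] E} {K : NNReal} (hK : LipschitzWith K h) (hh : ∀ x ∉ s, h x = 0)
    (hh' : ∀ x ∈ s, HasFDerivWithinAt h (h' x) s x) (hbound : ∀ x ∈ s, ‖h' x‖ ≤ K) :
    ∀ᶠ t : ℝ in 𝓝 0,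
      ∫ x in s, (ContinuousLinearMap.id ℝ E + t • h' x).det ∂μ = μ.real s := by
  have hsmall : ∀ᶠ t : ℝ in 𝓝 0, ‖t‖₊ * K < 1 :=
    (Continuous.tendsto' (by fun_prop) 0 0 (by simp)).eventually_lt_const one_pos
  filter_upwards [hsmall, eventually_det_id_add_smul_pos hbound] with t ht hdet
  have hlip : LipschitzWith (‖t‖₊ * K) fun x => t • h x :=
    (lipschitzWith_smul t).comp hK
  have hbij := bijective_add_of_lipschitzWith_lt_one ht hlip
  have himage := image_eq_self_of_bijective_of_eqOn_compl hbij (s := s) fun x hx => by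
    simp only [hh x hx, smul_zero, add_zero]
  have hderiv : ∀ x ∈ s, HasFDerivWithinAt (fun x => x + t • h x)
      (ContinuousLinearMap.id ℝ E + t • h' x) s x := fun x hx =>
    (hasFDerivWithinAt_id x s).add ((hh' x hx).const_smul t)
  have hchange := integral_image_eq_integral_abs_det_fderiv_smul μ hs hderiv hbij.injective.injOn
    fun _ => (1 : ℝ)
  rw [himage] at hchange
  calc ∫ x in s, (ContinuousLinearMap.id ℝ E + t • h' x).det ∂μ
      = ∫ x in s, |(ContinuousLinearMap.id ℝ E + t • h' x).det| • (1 : ℝ) ∂μ :=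
        setIntegral_congr_fun hs fun x hx => by simp [abs_of_pos (hdet x hx)]
    _ = ∫ _ in s, (1 : ℝ) ∂μ := hchange.symm
    _ = μ.real s := by simp

theorem integral_det_fderiv_eq_of_eqOn_frontier {s : Set E} (hs : IsCompact s) (hs' : Convex ℝ s)
    {G : E → E} (hG : ContDiff ℝ 1 G) (hGs : ∀ x ∈ frontier s, G x = x) :
    ∫ x in s, (fderiv ℝ G x).det ∂μ = μ.real s := by
  set h' : E → E →L[ℝ] E := fun x => fderiv ℝ G x - ContinuousLinearMap.id ℝ E
  have hderiv (x : E) : HasFDerivAt (fun x => G x - x) (h' x) x :=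
    (hG.differentiable one_ne_zero x).hasFDerivAt.sub (hasFDerivAt_id x)
  have hcont : Continuous h' := (hG.continuous_fderiv one_ne_zero).sub continuous_const
  obtain ⟨K, hK⟩ : ∃ K : NNReal, ∀ x ∈ s, ‖h' x‖₊ ≤ K := by
    obtain ⟨K, hK⟩ := hs.bddAbove_image (f := fun x => ‖h' x‖₊) (by fun_prop)
    exact ⟨K, fun x hx => hK ⟨x, hx, rfl⟩⟩
  have hlip : LipschitzWith K (s.indicator fun x => G x - x) :=
    lipschitzWith_indicator hs.isClosed
      (hs'.lipschitzOnWith_of_nnnorm_hasFDerivWithin_le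
        (fun x _ => (hderiv x).hasFDerivWithinAt) hK)
      fun x hx => sub_eq_zero.2 (hGs x hx)
  have hnhds := eventually_integral_det_id_add_smul_eq μ hs.measurableSet hlip
    (fun x hx => Set.indicator_of_notMem hx _)
    (fun x hx => (hderiv x).hasFDerivWithinAt.congr
      (fun y hy => Set.indicator_of_mem hy _) (Set.indicator_of_mem hx _)) hK
  -- Milnor–Rogers: the volume of the image of `s` under `id + t • (G - id)` is constant for small
  -- `t`, and it is given there by an expression which is polynomial in `t`.
  obtain ⟨q, hq⟩ := exists_eval_eq_integral_det_id_add_smul (μ := μ.restrict s) (A := h')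
    fun t => (ContinuousLinearMap.continuous_det.comp
      (continuous_const.add (hcont.const_smul t))).continuousOn.integrableOn_compact hs
  have hqconst : q = Polynomial.C (μ.real s) := by
    refine Polynomial.eq_of_infinite_eval_eq _ _ ((infinite_of_mem_nhds (0 : ℝ) hnhds).mono ?_)
    intro t ht
    simpa [hq] using ht
  have hq_one := hq 1
  simp only [hqconst, h', Polynomial.eval_C, one_smul, add_sub_cancel] at hq_one
  exact hq_one.symm

end FiniteDimensional

section InnerProductSpace

variable {E : Type*} [NormedAddCommGroup E] [InnerProductSpace ℝ E] [FiniteDimensional ℝ E]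

open RealInnerProductSpace in
theorem det_eq_zero_of_hasFDerivAt_of_norm_eventually_eq {G : E → E} {G' : E →L[ℝ] E} {x : E}
    {R : ℝ} (hR : R ≠ 0) (hG : HasFDerivAt G G' x) (hnorm : ∀ᶠ y in 𝓝 x, ‖G y‖ = R) :
    G'.det = 0 := by
  have horth (v : E) : ⟪G x, G' v⟫ = 0 := by
    have hconst : HasFDerivAt (fun y => ‖G y‖ ^ 2) (0 : E →L[ℝ] ℝ) x :=
      (hasFDerivAt_const (R ^ 2) x).congr_of_eventuallyEq (hnorm.mono fun y hy => by simp [hy])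
    simpa using DFunLike.congr_fun (hG.norm_sq.unique hconst) v
  by_contra hdet
  have hsurj : Function.Surjective G'.toLinearMap := ((Module.End.isUnit_iff _).1
    ((LinearMap.isUnit_iff_isUnit_det _).2 (isUnit_iff_ne_zero.2 hdet))).2
  obtain ⟨v, hv⟩ := hsurj (G x)
  have hGx : G x = 0 := inner_self_eq_zero.1 (hv ▸ horth v)
  exact hR (by simpa [hGx] using hnorm.self_of_nhds.symm)

theorem exists_norm_eq_and_ne_of_contDiff_of_forall_norm_eq {R : ℝ} (hR : 0 < R) {G : E → E}
    (hG : ContDiff ℝ 1 G) (hnorm : ∀ x, ‖G x‖ = R) : ∃ x, ‖x‖ = R ∧ G x ≠ x := by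
  by_contra! hfix
  let _ : MeasurableSpace E := borel E
  have : BorelSpace E := ⟨rfl⟩
  have hvol := integral_det_fderiv_eq_of_eqOn_frontier volume (isCompact_closedBall (0 : E) R)
    (convex_closedBall 0 R) hG fun x hx => hfix x (by
      simpa using Metric.frontier_closedBall_subset_sphere hx)
  have hdet (x : E) : (fderiv ℝ G x).det = 0 :=
    det_eq_zero_of_hasFDerivAt_of_norm_eventually_eq hR.ne'
      (hG.differentiable one_ne_zero x).hasFDerivAt (Eventually.of_forall hnorm)
  simp only [hdet, integral_zero] at hvol
  exact (measureReal_ne_zero_iff (by exact measure_closedBall_lt_top.ne)).2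
    (Metric.measure_closedBall_pos volume 0 hR).ne' hvol.symm

theorem exists_fixedPoint_of_contDiff_of_bounded {p : E → E} (hp : ContDiff ℝ 1 p) {M : ℝ}
    (hM : ∀ x, ‖p x‖ ≤ M) : ∃ x, p x = x := by
  have hM₀ : 0 ≤ M := (norm_nonneg _).trans (hM 0)
  let χ : ContDiffBump (0 : E) := ⟨M + 1, M + 2, by positivity, by linarith⟩
  set F : E → E := fun x => x - χ x • p x
  by_contra! hne
  have hF₀ (x : E) : F x ≠ 0 := by
    intro hx
    have hxp : x = χ x • p x := sub_eq_zero.1 hx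
    have hxM : ‖x‖ ≤ M := by
      rw [hxp, norm_smul, Real.norm_of_nonneg χ.nonneg]
      exact (mul_le_of_le_one_left (norm_nonneg _) χ.le_one).trans (hM x)
    have hχ : χ x = 1 := χ.one_of_mem_closedBall (by simpa using hxM.trans (by linarith))
    rw [hχ, one_smul] at hxp
    exact hne x hxp.symm
  have hF : ContDiff ℝ 1 F := contDiff_id.sub (χ.contDiff.smul hp)
  have hR : 0 < M + 2 := by positivity
  obtain ⟨x, hx, hGx⟩ := exists_norm_eq_and_ne_of_contDiff_of_forall_norm_eq hR
    (G := fun x => ((M + 2) * ‖F x‖⁻¹) • F x)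
    ((contDiff_const.mul ((hF.norm ℝ hF₀).inv fun x => norm_ne_zero_iff.2 (hF₀ x))).smul hF)
    fun x => by
      rw [norm_smul, norm_mul, norm_inv, norm_norm, Real.norm_of_nonneg hR.le, mul_assoc,
        inv_mul_cancel₀ (norm_ne_zero_iff.2 (hF₀ x)), mul_one]
  have hχx : χ x = 0 := χ.zero_of_le_dist (by simpa using hx.ge)
  have hFx : F x = x := by simp [F, hχx]
  refine hGx ?_
  rw [hFx, hx, mul_inv_cancel₀ hR.ne', one_smul]

theorem exists_fixedPoint_of_uniformContinuous_of_bounded {f : E → E} (hf : UniformContinuous f)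
    {M : ℝ} (hM : ∀ x, ‖f x‖ ≤ M) : ∃ x, f x = x := by
  have happrox (n : ℕ) : ∃ x, ‖x‖ ≤ M + 1 ∧ dist (f x) x ≤ 1 / (n + 1 : ℝ) := by
    have hε : (0 : ℝ) < 1 / (n + 1) := by positivity
    have hε1 : 1 / (n + 1 : ℝ) ≤ 1 := by
      rw [div_le_one (by positivity)]
      linarith [(Nat.cast_nonneg n : (0 : ℝ) ≤ n)]
    obtain ⟨p, hp, hpf⟩ := hf.exists_contDiff_dist_le hε
    have hpM (x : E) : ‖p x‖ ≤ M + 1 := by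
      have h := norm_le_norm_add_norm_sub' (p x) (f x)
      rw [← dist_eq_norm] at h
      linarith [hpf x, hM x]
    obtain ⟨x, hx⟩ := exists_fixedPoint_of_contDiff_of_bounded
      (hp.of_le (by exact_mod_cast le_top)) hpM
    refine ⟨x, hx ▸ hpM x, ?_⟩
    have h := (hpf x).le
    rwa [hx, dist_comm] at h
  choose x hxM hx using happrox
  obtain ⟨y, -, s, hs, hy⟩ := (isCompact_closedBall (0 : E) (M + 1)).tendsto_subseq
    fun n => mem_closedBall_zero_iff.2 (hxM n)
  refine ⟨y, dist_le_zero.1 (le_of_tendsto_of_tendsto' (f := fun n => dist (f (x (s n))) (x (s n)))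
    (((hf.continuous.tendsto y).comp hy).dist hy)
    (tendsto_one_div_add_atTop_nhds_zero_nat.comp hs.tendsto_atTop) fun n => hx (s n))⟩

end InnerProductSpace

theorem lipschitzWith_sup_inf {ι : Type*} [Fintype ι] (l h : ι → ℝ) :
    LipschitzWith 1 fun x : ι → ℝ => (x ⊔ l) ⊓ h := by
  refine LipschitzWith.of_dist_le_mul fun a b => ?_
  rw [NNReal.coe_one, one_mul]
  refine (dist_pi_le_iff dist_nonneg).2 fun i => le_trans ?_ (dist_le_pi_dist a b i)
  exact (abs_inf_sub_inf_le_abs _ _ _).trans (abs_sup_sub_sup_le_abs _ _ _)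

theorem exists_fixedPoint_of_mapsTo_Icc {ι : Type*} [Finite ι] {l h : ι → ℝ} (hlh : l ≤ h)
    {f : (ι → ℝ) → ι → ℝ} (hf : ContinuousOn f (Set.Icc l h))
    (hmaps : Set.MapsTo f (Set.Icc l h) (Set.Icc l h)) : ∃ x ∈ Set.Icc l h, f x = x := by
  cases nonempty_fintype ι
  set clamp : (ι → ℝ) → ι → ℝ := fun x => (x ⊔ l) ⊓ h
  have hclamp (x : ι → ℝ) : clamp x ∈ Set.Icc l h := ⟨le_inf le_sup_right hlh, inf_le_right⟩
  have hclamp_eq (x : ι → ℝ) (hx : x ∈ Set.Icc l h) : clamp x = x := by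
    simp only [clamp, sup_eq_left.2 hx.1, inf_eq_left.2 hx.2]
  have huc : UniformContinuous fun x => f (clamp x) :=
    uniformContinuousOn_univ.1 <|
      (isCompact_Icc.uniformContinuousOn_of_continuous hf).comp
        (lipschitzWith_sup_inf l h).uniformContinuous.uniformContinuousOn fun x _ => hclamp x
  set g : EuclideanSpace ℝ ι → EuclideanSpace ℝ ι := fun x => WithLp.toLp 2 (f (clamp x.ofLp))
  have hg : UniformContinuous g := (PiLp.uniformContinuous_toLp 2 _).comp
    (huc.comp (PiLp.uniformContinuous_ofLp 2 _))
  have hcompact : IsCompact (WithLp.toLp 2 '' Set.Icc l h) :=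
    isCompact_Icc.image (PiLp.continuous_toLp 2 fun _ : ι => ℝ)
  obtain ⟨M, hM⟩ := hcompact.isBounded.exists_norm_le
  obtain ⟨x, hx⟩ := exists_fixedPoint_of_uniformContinuous_of_bounded hg fun x =>
    hM _ ⟨_, hmaps (hclamp x.ofLp), rfl⟩
  have hfx : f (clamp x.ofLp) = x.ofLp := congrArg WithLp.ofLp hx
  have hxI : x.ofLp ∈ Set.Icc l h := hfx ▸ hmaps (hclamp _)
  exact ⟨x.ofLp, hxI, by rwa [hclamp_eq _ hxI] at hfx⟩

end Brouwer

section BoxRetraction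

theorem continuousOn_of_isCompact_of_isClosed {X Y Z : Type*} [TopologicalSpace X]
    [TopologicalSpace Y] [TopologicalSpace Z] {c : X → Y → Z}
    (hc : Continuous fun p : X × Y => c p.1 p.2) {S : Set X} {K : Set Y} (hK : IsCompact K)
    {M : Set Z} (hM : IsClosed M) {s : X → Y} (hs : ∀ x ∈ S, s x ∈ K)
    (hsM : ∀ x ∈ S, c x (s x) ∈ M)
    (huniq : ∀ x ∈ S, ∀ y, c x y ∈ M → c x y = c x (s x)) :
    ContinuousOn (fun x => c x (s x)) S := by
  intro x hx
  refine (tendsto_iff_ultrafilter _ _ _).2 fun F hF => ?_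
  have hFS : S ∈ (F : Filter X) := le_principal_iff.1 (hF.trans inf_le_right)
  obtain ⟨y, -, hy⟩ := hK.ultrafilter_le_nhds (F.map s)
    (le_principal_iff.2 (Ultrafilter.mem_map.2 (mem_of_superset hFS hs)))
  have hlim : Tendsto (fun z => c z (s z)) F (𝓝 (c x y)) :=
    (hc.tendsto (x, y)).comp (Tendsto.prodMk_nhds (hF.trans inf_le_left) hy)
  have hy' := huniq x hx y (hM.mem_of_tendsto hlim (mem_of_superset hFS hsM))
  simpa only [hy'] using hlim

variable {ι : Type*}

/-- The path through `x` along the diagonal direction, truncated to the box `[l, t]`: it climbs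
monotonically from the bottom corner to the top corner. -/
def boxArc (l t x : ι → ℝ) (s : ℝ) : ι → ℝ := ((x + fun _ => s) ⊔ l) ⊓ t

variable {l t x : ι → ℝ} {s : ℝ}

theorem continuous_boxArc : Continuous fun p : (ι → ℝ) × ℝ => boxArc l t p.1 p.2 := by
  refine continuous_pi fun i => ?_
  exact ((((continuous_apply i).comp continuous_fst).add continuous_snd).max
    continuous_const).min continuous_const

theorem monotone_boxArc : Monotone (boxArc l t x) := fun _ _ hab =>
  inf_le_inf_right _ (sup_le_sup_right (add_le_add_right (fun _ => hab) _) _)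

theorem boxArc_mem_Icc (hlt : l ≤ t) : boxArc l t x s ∈ Set.Icc l t :=
  ⟨le_inf le_sup_right hlt, inf_le_right⟩

theorem boxArc_zero (hx : x ∈ Set.Icc l t) : boxArc l t x 0 = x := by
  have hx₀ : (x + fun _ => (0 : ℝ)) = x := add_zero x
  simp only [boxArc, hx₀, sup_eq_left.2 hx.1, inf_eq_left.2 hx.2]

theorem boxArc_eq_bot (hlt : l ≤ t) (h : ∀ i, x i + s ≤ l i) : boxArc l t x s = l := by
  have h' : (x + fun _ => s) ≤ l := h
  simp only [boxArc, sup_eq_right.2 h', inf_eq_left.2 hlt]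

theorem boxArc_eq_top (h : ∀ i, t i ≤ x i + s) : boxArc l t x s = t :=
  inf_eq_right.2 (le_sup_of_le_left h)

theorem exists_boxArc_mem_frontier {A : Set (ι → ℝ)} (hlA : l ∈ A) (htA : t ∉ A) {D : ℝ}
    (hD : 0 ≤ D) (htD : ∀ i, t i ≤ l i + D) (hx : x ∈ Set.Icc l t) :
    ∃ s ∈ Set.Icc (-D) D, boxArc l t x s ∈ frontier A := by
  have hbot : boxArc l t x (-D) = l :=
    boxArc_eq_bot (hx.1.trans hx.2) fun i => by linarith [htD i, hx.2 i]
  have htop : boxArc l t x D = t := boxArc_eq_top fun i => by linarith [htD i, hx.1 i]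
  have hpre : IsPreconnected (boxArc l t x '' Set.Icc (-D) D) :=
    isPreconnected_Icc.image _
      (continuous_boxArc.comp (Continuous.prodMk_right x)).continuousOn
  obtain ⟨_, ⟨s, hs, rfl⟩, hsA⟩ := inter_frontier_nonempty_of_isPreconnected (t := A) hpre
    ⟨l, ⟨-D, by simpa using hD, hbot⟩, hlA⟩ ⟨t, ⟨D, by simpa using hD, htop⟩, htA⟩
  exact ⟨s, hs, hsA⟩

theorem exists_retraction_frontier_of_isAntichain [Finite ι] {A : Set (ι → ℝ)}
    (hA : IsAntichain (· ≤ ·) (frontier A)) (hlt : l ≤ t) (hlA : l ∈ A) (htA : t ∉ A) :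
    ∃ r : (ι → ℝ) → ι → ℝ, ContinuousOn r (Set.Icc l t) ∧
      (∀ x ∈ Set.Icc l t, r x ∈ Set.Icc l t ∩ frontier A) ∧
      ∀ x ∈ Set.Icc l t ∩ frontier A, r x = x := by
  obtain ⟨D, hD⟩ := (Set.finite_range fun i => t i - l i).bddAbove
  have htD (i : ι) : t i ≤ l i + max D 0 := by
    linarith [hD ⟨i, rfl⟩, le_max_left D 0]
  choose! s hs hsA using fun x => exists_boxArc_mem_frontier (x := x) hlA htA (le_max_right D 0) htD
  have huniq : ∀ x ∈ Set.Icc l t, ∀ s', boxArc l t x s' ∈ frontier A →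
      boxArc l t x s' = boxArc l t x (s x) := by
    intro x hx s' hs'
    rcases le_total s' (s x) with h | h
    · exact hA.eq hs' (hsA x hx) (monotone_boxArc h)
    · exact (hA.eq (hsA x hx) hs' (monotone_boxArc h)).symm
  refine ⟨fun x => boxArc l t x (s x), ?_, fun x hx => ⟨boxArc_mem_Icc hlt, hsA x hx⟩, ?_⟩
  · exact continuousOn_of_isCompact_of_isClosed continuous_boxArc isCompact_Icc isClosed_frontier
      hs hsA huniq
  · rintro x ⟨hx, hxA⟩
    exact (huniq x hx 0 (by rwa [boxArc_zero hx])).symm.trans (boxArc_zero hx)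

end BoxRetraction

section MonotoneMaps

variable {ι : Type*} {P : (ι → ℝ) → ι → ℝ} {l h t u v : ι → ℝ}

theorem exists_fixedPoint_mem_Icc_of_monotone (hc : Continuous P) (hmono : Monotone P)
    (hlh : l ≤ h) (hl : l ≤ P l) (hh : P h ≤ h) : ∃ u ∈ Set.Icc l h, P u = u := by
  have hanti : Antitone fun n => P^[n] h := hmono.antitone_iterate_of_map_le hh
  have hlow (n : ℕ) : l ≤ P^[n] h :=
    (hmono.monotone_iterate_of_le_map hl n.zero_le).trans (hmono.iterate n hlh)
  have hlim : Tendsto (fun n => P^[n] h) atTop (𝓝 fun i => ⨅ n, P^[n] h i) :=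
    tendsto_pi_nhds.2 fun i => tendsto_atTop_ciInf (fun a b hab => hanti hab i)
      ⟨l i, Set.forall_mem_range.2 fun n => hlow n i⟩
  exact ⟨_, ⟨ge_of_tendsto' hlim hlow, le_of_tendsto' hlim fun n => hanti n.zero_le⟩,
    isFixedPt_of_tendsto_iterate hlim hc.continuousAt⟩

/-- A continuous monotone self-map of `ι → ℝ` some positive iterate of which strictly separates, in
every coordinate, any two distinct comparable points. -/
structure IsEventuallyStronglyMonotone (P : (ι → ℝ) → ι → ℝ) : Prop where
  continuous : Continuous P
  monotone : Monotone P
  exists_strongLT_iterate : ∃ n, 0 < n ∧ ∀ u v, u < v → StrongLT (P^[n] u) (P^[n] v)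

/-- The basin of a supersolution `h`: the points whose orbit under `P` gets below `h` in every
coordinate. -/
def eventuallyBelow (P : (ι → ℝ) → ι → ℝ) (h : ι → ℝ) : Set (ι → ℝ) :=
  {u | ∃ n, StrongLT (P^[n] u) h}

theorem isLowerSet_eventuallyBelow (hmono : Monotone P) : IsLowerSet (eventuallyBelow P h) :=
  fun _ _ hvu ⟨n, hn⟩ => ⟨n, strongLT_of_le_of_strongLT (hmono.iterate n hvu) hn⟩

theorem isOpen_setOf_strongLT [Finite ι] {X : Type*} [TopologicalSpace X] {f g : X → ι → ℝ}
    (hf : Continuous f) (hg : Continuous g) : IsOpen {x | StrongLT (f x) (g x)} := by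
  simp only [StrongLT, Set.ofPred_forall]
  exact isOpen_iInter_of_finite fun i => isOpen_lt (by fun_prop) (by fun_prop)

theorem isOpen_eventuallyBelow [Finite ι] (hc : Continuous P) : IsOpen (eventuallyBelow P h) := by
  rw [eventuallyBelow, Set.ofPred_exists]
  exact isOpen_iUnion fun n => isOpen_setOf_strongLT (hc.iterate n) continuous_const

theorem not_le_of_mem_eventuallyBelow (hmono : Monotone P) (hl : l ≤ P l) (hlh : ¬ l ≤ h)
    (hu : u ∈ eventuallyBelow P h) : ¬ l ≤ u := by
  obtain ⟨n, hn⟩ := hu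
  exact fun hlu => hlh ((hmono.monotone_iterate_of_le_map hl n.zero_le).trans
    ((hmono.iterate n hlu).trans hn.le))

namespace IsEventuallyStronglyMonotone

theorem apply_mem_eventuallyBelow_iff (hP : IsEventuallyStronglyMonotone P) (hh : P h ≤ h) :
    P u ∈ eventuallyBelow P h ↔ u ∈ eventuallyBelow P h := by
  refine ⟨fun ⟨m, hm⟩ => ⟨m + 1, hm⟩, fun ⟨m, hm⟩ => ?_⟩
  cases isEmpty_or_nonempty ι
  · exact ⟨0, fun i => isEmptyElim i⟩
  obtain ⟨n, hn₀, hn⟩ := hP.exists_strongLT_iterate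
  refine ⟨n - 1 + m, ?_⟩
  rw [← Function.iterate_succ_apply, ← Nat.succ_add, Nat.succ_eq_add_one, Nat.sub_add_cancel hn₀,
    Function.iterate_add_apply]
  exact strongLT_of_strongLT_of_le (hn _ _ hm.lt)
    (hP.monotone.antitone_iterate_of_map_le hh n.zero_le)

theorem mapsTo_frontier_eventuallyBelow [Finite ι] (hP : IsEventuallyStronglyMonotone P)
    (hh : P h ≤ h) :
    Set.MapsTo P (frontier (eventuallyBelow P h)) (frontier (eventuallyBelow P h)) := by
  intro u hu
  rw [(isOpen_eventuallyBelow hP.continuous).frontier_eq] at hu ⊢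
  exact ⟨map_mem_closure hP.continuous hu.1 fun a => (hP.apply_mem_eventuallyBelow_iff hh).2,
    fun h' => hu.2 ((hP.apply_mem_eventuallyBelow_iff hh).1 h')⟩

theorem isAntichain_frontier_eventuallyBelow [Finite ι] (hP : IsEventuallyStronglyMonotone P)
    (hh : P h ≤ h) : IsAntichain (· ≤ ·) (frontier (eventuallyBelow P h)) := by
  intro u hu v hv hne huv
  obtain ⟨n, -, hn⟩ := hP.exists_strongLT_iterate
  have hu' := (hP.mapsTo_frontier_eventuallyBelow hh).iterate n hu
  have hv' := (hP.mapsTo_frontier_eventuallyBelow hh).iterate n hv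
  rw [(isOpen_eventuallyBelow hP.continuous).frontier_eq] at hu' hv'
  obtain ⟨a, ha, haA⟩ := mem_closure_iff.1 hv'.1 {w | StrongLT (P^[n] u) w}
    (isOpen_setOf_strongLT continuous_const continuous_id) (hn u v (huv.lt_of_ne hne))
  exact hu'.2 (isLowerSet_eventuallyBelow hP.monotone ha.le haA)

theorem exists_fixedPoint_mem_frontier [Finite ι] (hP : IsEventuallyStronglyMonotone P)
    (hh : P h ≤ h) (hl : l ≤ P l) (ht : P t ≤ t) (hlt : l ≤ t) (hlA : l ∈ eventuallyBelow P h)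
    (htA : t ∉ eventuallyBelow P h) : ∃ u ∈ frontier (eventuallyBelow P h), P u = u := by
  obtain ⟨r, hr, hrA, hrid⟩ := exists_retraction_frontier_of_isAntichain
    (hP.isAntichain_frontier_eventuallyBelow hh) hlt hlA htA
  have hmaps : Set.MapsTo P (Set.Icc l t) (Set.Icc l t) := fun x hx =>
    ⟨hl.trans (hP.monotone hx.1), (hP.monotone hx.2).trans ht⟩
  obtain ⟨x, hx, hfix⟩ := exists_fixedPoint_of_mapsTo_Icc hlt (hP.continuous.comp_continuousOn hr)
    fun x hx => hmaps (hrA x hx).1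
  have hxA : x ∈ frontier (eventuallyBelow P h) :=
    hfix ▸ hP.mapsTo_frontier_eventuallyBelow hh (hrA x hx).2
  exact ⟨x, hxA, by simpa only [Function.comp_apply, hrid x ⟨hx, hxA⟩] using hfix⟩

theorem strongLT_fixedPoint_of_lt_map (hP : IsEventuallyStronglyMonotone P) (hl : l < P l)
    (hu : P u = u) (hlu : l ≤ u) : StrongLT l u := by
  obtain ⟨n, -, hn⟩ := hP.exists_strongLT_iterate
  have hlt : l < u := hlu.lt_of_ne (by rintro rfl; exact hl.ne hu.symm)
  have h := hn l u hlt
  rw [Function.iterate_fixed hu] at h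
  exact strongLT_of_le_of_strongLT (hP.monotone.monotone_iterate_of_le_map hl.le n.zero_le) h

theorem fixedPoint_strongLT_of_map_lt (hP : IsEventuallyStronglyMonotone P) (hh : P h < h)
    (hu : P u = u) (huh : u ≤ h) : StrongLT u h := by
  obtain ⟨n, -, hn⟩ := hP.exists_strongLT_iterate
  have hlt : u < h := huh.lt_of_ne (by rintro rfl; exact hh.ne hu)
  have h' := hn u h hlt
  rw [Function.iterate_fixed hu] at h'
  exact strongLT_of_strongLT_of_le h' (hP.monotone.antitone_iterate_of_map_le hh.le n.zero_le)

theorem exists_fixedPoint_not_le [Finite ι] (hP : IsEventuallyStronglyMonotone P)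
    (hl : l < P l) (hh : P h < h) (hlh : ¬ l ≤ h) {l₀ : ι → ℝ} (hl₀ : l₀ ≤ P l₀)
    (hl₀h : StrongLT l₀ h) (ht : P t ≤ t) (hl₀t : l₀ ≤ t) (hlt : l ≤ t) :
    ∃ w, P w = w ∧ ¬ l ≤ w ∧ ¬ w ≤ h := by
  obtain ⟨w, hwA, hw⟩ := hP.exists_fixedPoint_mem_frontier hh.le hl₀ ht hl₀t ⟨0, hl₀h⟩
    fun htA => not_le_of_mem_eventuallyBelow hP.monotone hl.le hlh htA hlt
  rw [(isOpen_eventuallyBelow hP.continuous).frontier_eq] at hwA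
  refine ⟨w, hw, fun hlw => ?_, fun hwh =>
    hwA.2 ⟨0, hP.fixedPoint_strongLT_of_map_lt hh hw hwh⟩⟩
  obtain ⟨v, hlv, hvA⟩ := mem_closure_iff.1 hwA.1 {v | StrongLT l v}
    (isOpen_setOf_strongLT continuous_const continuous_id)
    (hP.strongLT_fixedPoint_of_lt_map hl hw hlw)
  exact not_le_of_mem_eventuallyBelow hP.monotone hl.le hlh hvA hlv.le

end IsEventuallyStronglyMonotone

theorem exists_nat_strongLT_add [Finite ι] (u v : ι → ℝ) : ∃ m : ℕ, StrongLT u (v + m) := by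
  obtain ⟨M, hM⟩ := (Set.finite_range fun i => u i - v i).bddAbove
  obtain ⟨m, hm⟩ := exists_nat_gt M
  refine ⟨m, fun i => ?_⟩
  have hi : u i - v i ≤ M := hM ⟨i, rfl⟩
  simp only [Pi.add_apply, Pi.natCast_apply]
  linarith

theorem exists_int_isGreatest_add_le [Finite ι] [Nonempty ι] (u h : ι → ℝ) :
    ∃ p : ℤ, IsGreatest {j : ℤ | u + j ≤ h} p := by
  obtain ⟨m, hm⟩ := exists_nat_strongLT_add u h
  obtain ⟨i₀⟩ := ‹Nonempty ι›
  obtain ⟨p, hp, hpmax⟩ := Int.exists_greatest_of_bdd (P := fun j : ℤ => u + j ≤ h)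
    ⟨⌊h i₀ - u i₀⌋, fun z hz => Int.le_floor.2 (le_sub_iff_add_le'.2 (hz i₀))⟩
    ⟨-m, by simpa [← sub_eq_add_neg, sub_le_iff_le_add] using hm.le⟩
  exact ⟨p, hp, hpmax⟩

theorem IsEventuallyStronglyMonotone.exists_two_fixedPoints [Finite ι]
    (hP : IsEventuallyStronglyMonotone P) (htrans : ∀ u (j : ℤ), P (u + j) = P u + j)
    (hl : l < P l) (hh : P h < h) :
    ∃ u v, P u = u ∧ P v = v ∧ ∀ j : ℤ, v ≠ u + j := by
  have : Nonempty ι := (Pi.lt_def.1 hl).2.nonempty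
  have hsub (j : ℤ) : l + j < P (l + j) := by rw [htrans]; gcongr
  have hsup (j : ℤ) : P (h + j) < h + j := by rw [htrans]; gcongr
  have hcast {j k : ℤ} (hjk : j ≤ k) (w : ι → ℝ) : w + j ≤ w + k := by
    have : (j : ℝ) ≤ k := by exact_mod_cast hjk
    exact fun i => by simpa using this
  obtain ⟨a, ha⟩ := exists_nat_strongLT_add l h
  obtain ⟨u, -, hu⟩ := exists_fixedPoint_mem_Icc_of_monotone hP.continuous hP.monotone
    (by simpa using ha.le) hl.le (hsup a).le
  obtain ⟨p, hp, hpmax⟩ := exists_int_isGreatest_add_le u h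
  obtain ⟨q, hq, hqmax⟩ := exists_int_isGreatest_add_le l (u + (p + 1 : ℤ))
  have hqp : ¬ l + q ≤ u + p := fun hle => (lt_add_one q).not_ge <| hqmax <| by
    simpa only [Set.mem_ofPred_eq, Int.cast_add, ← add_assoc] using add_le_add_left hle _
  by_cases hqh : l + q ≤ h
  · obtain ⟨v, hv, hvfix⟩ := exists_fixedPoint_mem_Icc_of_monotone hP.continuous hP.monotone
      hqh (hsub q).le hh.le
    refine ⟨u, v, hu, hvfix, ?_⟩
    rintro j rfl
    exact hqp (hv.1.trans (hcast (hpmax hv.2) u))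
  · obtain ⟨b, hb⟩ := exists_nat_strongLT_add (l + (q : ι → ℝ)) h
    have hbh : StrongLT (l + ((q - b : ℤ) : ι → ℝ)) h := fun i => by
      simpa [← add_sub_assoc, sub_lt_iff_lt_add] using hb i
    have hhb : h ≤ h + (b : ℤ) := by simp
    obtain ⟨w, hw, hlw, hwh⟩ := hP.exists_fixedPoint_not_le (hsub q) hh hqh (hsub _).le hbh
      (hsup b).le (hbh.le.trans hhb) (by simpa using hb.le)
    refine ⟨u, w, hu, hw, ?_⟩
    rintro j rfl
    rcases le_or_gt j p with hj | hj
    · exact hwh ((hcast hj u).trans hp)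
    · exact hlw (hq.trans (hcast hj u))

end MonotoneMaps

namespace TwistMap

section Momenta

theorem exists_forall_le_of_periodic {f : Plane → ℝ} (hf : Continuous f)
    (hper : ∀ (z : Plane) (m n : ℤ), f (z + ((m : ℝ), (n : ℝ))) = f z) :
    ∃ z₀, ∀ z, f z₀ ≤ f z := by
  obtain ⟨z₀, -, hz₀⟩ := (isCompact_Icc (a := (0 : Plane)) (b := 1)).exists_isMinOn
    ⟨0, by simp⟩ hf.continuousOn
  refine ⟨z₀, fun z => ?_⟩
  have hfract : (Int.fract z.1, Int.fract z.2) ∈ Set.Icc (0 : Plane) 1 :=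
    ⟨⟨Int.fract_nonneg _, Int.fract_nonneg _⟩, (Int.fract_lt_one _).le, (Int.fract_lt_one _).le⟩
  have hz := hper (Int.fract z.1, Int.fract z.2) ⌊z.1⌋ ⌊z.2⌋
  rw [Prod.mk_add_mk, Int.fract_add_floor, Int.fract_add_floor] at hz
  exact (hz₀ hfract).trans_eq hz.symm

theorem antilipschitzWith_of_le_deriv {f : ℝ → ℝ} (hf : Differentiable ℝ f) {c : NNReal}
    (hc : 0 < c) (hcf : ∀ t, c ≤ deriv f t) : AntilipschitzWith c⁻¹ f := by
  refine AntilipschitzWith.of_le_mul_dist fun x y => ?_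
  wlog hxy : y ≤ x generalizing x y
  · rw [dist_comm, dist_comm (f x)]
    exact this y x (le_of_not_ge hxy)
  have hmean := (mul_sub_le_image_sub_of_le_deriv hf hcf hxy).trans (le_abs_self _)
  rw [NNReal.coe_inv, le_inv_mul_iff₀ (by exact_mod_cast hc), Real.dist_eq, Real.dist_eq,
    abs_of_nonneg (sub_nonneg.2 hxy)]
  exact hmean

theorem lipschitzWith_implicit {X Y Z : Type*} [PseudoEMetricSpace X] [PseudoEMetricSpace Y]
    [PseudoEMetricSpace Z] {K C : NNReal} {F : X → Y → Z} {G : X → Z → Y}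
    (hF : ∀ y, LipschitzWith K fun x => F x y) (hF' : ∀ x, AntilipschitzWith C (F x))
    (hG : ∀ x z, F x (G x z) = z) : LipschitzWith (C * (K + 1)) fun p : X × Z => G p.1 p.2 := by
  rintro ⟨x, z⟩ ⟨x', z'⟩
  calc edist (G x z) (G x' z')
      ≤ C * edist (F x' (G x z)) z' := by simpa only [hG] using hF' x' (G x z) (G x' z')
    _ ≤ C * (edist (F x' (G x z)) (F x (G x z)) + edist z z') := by
        gcongr
        simpa only [hG] using edist_triangle (F x' (G x z)) (F x (G x z)) z'
    _ ≤ C * (K * edist x x' + edist z z') := by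
        gcongr
        simpa only [edist_comm x] using hF (G x z) x' x
    _ ≤ C * (K * edist (x, z) (x', z') + edist (x, z) (x', z')) := by
        gcongr
        · exact le_max_left _ _
        · exact le_max_right _ _
    _ = (C * (K + 1) : NNReal) * edist (x, z) (x', z') := by push_cast; ring

variable {T : Plane → Plane}

theorem IsTQ.apply_add (hT : IsTQ T) (z : Plane) (m n : ℤ) :
    T (z + ((m : ℝ), (n : ℝ))) = T z + ((m : ℝ) + n, (n : ℝ)) := by
  have happly := hT.apply_add_int z.1 z.2 m n
  rw [add_assoc] at happly
  exact happly

theorem IsTQ.contDiff (hT : IsTQ T) : ContDiff ℝ 1 T := hT.diffeo.1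

theorem IsTQ.bijective (hT : IsTQ T) : Function.Bijective T := by
  obtain ⟨-, S, -, hleft, hright⟩ := hT.diffeo
  exact ⟨hleft.injective, hright.surjective⟩

theorem IsTQ.fderiv_add (hT : IsTQ T) (z : Plane) (m n : ℤ) :
    fderiv ℝ T (z + ((m : ℝ), (n : ℝ))) = fderiv ℝ T z := by
  rw [← fderiv_comp_add_right]
  simp only [hT.apply_add, fderiv_add_const]

theorem IsTQ.exists_lipschitzWith (hT : IsTQ T) : ∃ K, LipschitzWith K T := by
  have hcont : Continuous (fderiv ℝ T) := hT.contDiff.continuous_fderiv one_ne_zero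
  obtain ⟨z₀, hz₀⟩ := exists_forall_le_of_periodic (f := fun z => -‖fderiv ℝ T z‖)
    (by fun_prop) fun z m n => by rw [hT.fderiv_add]
  exact ⟨‖fderiv ℝ T z₀‖₊, lipschitzWith_of_nnnorm_fderiv_le
    (hT.contDiff.differentiable one_ne_zero) fun z =>
      show ‖fderiv ℝ T z‖ ≤ _ from neg_le_neg_iff.1 (hz₀ z)⟩

theorem IsTQ.hasDerivAt_fst (hT : IsTQ T) (a I : ℝ) :
    HasDerivAt (fun t => (T (a, t)).1) (fderiv ℝ T (a, I) (0, 1)).1 I := by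
  have hTd : HasFDerivAt T (fderiv ℝ T (a, I)) (a, I) :=
    (hT.contDiff.differentiable one_ne_zero _).hasFDerivAt
  exact hasFDerivAt_fst.comp_hasDerivAt I
    (hTd.comp_hasDerivAt I ((hasDerivAt_const I a).prodMk (hasDerivAt_id I)))

theorem IsTQ.exists_antilipschitzWith_fst (hT : IsTQ T) :
    ∃ C, ∀ a, AntilipschitzWith C fun I => (T (a, I)).1 := by
  have hcont : Continuous (fderiv ℝ T) := hT.contDiff.continuous_fderiv one_ne_zero
  obtain ⟨z₀, hz₀⟩ := exists_forall_le_of_periodic (f := fun z => (fderiv ℝ T z (0, 1)).1)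
    (by fun_prop) fun z m n => by rw [hT.fderiv_add]
  have hpos : 0 < (fderiv ℝ T z₀ (0, 1)).1 :=
    (hT.hasDerivAt_fst z₀.1 z₀.2).deriv ▸ hT.twist z₀.1 z₀.2
  refine ⟨⟨_, hpos.le⟩⁻¹, fun a => antilipschitzWith_of_le_deriv
    (fun t => (hT.hasDerivAt_fst a t).differentiableAt) hpos fun t => ?_⟩
  rw [(hT.hasDerivAt_fst a t).deriv]
  exact hz₀ (a, t)

theorem IsTQ.strictMono_fst (hT : IsTQ T) (a : ℝ) : StrictMono fun I => (T (a, I)).1 :=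
  strictMono_of_deriv_pos (hT.twist a)

theorem IsTQ.surjective_fst (hT : IsTQ T) (a : ℝ) : Function.Surjective fun I => (T (a, I)).1 :=
  (continuous_fst.comp (hT.contDiff.continuous.comp (Continuous.prodMk_right a))).surjective
    (hT.horiz_top a) (hT.horiz_bot a)

/-- The momentum `I` with which a point above `a` must start in order to be mapped above `b`. -/
noncomputable def initialMomentum (T : Plane → Plane) (a b : ℝ) : ℝ :=
  Function.invFun (fun I => (T (a, I)).1) b

/-- The momentum of the image above `b` of the point above `a` with momentum
`initialMomentum T a b`. -/
noncomputable def finalMomentum (T : Plane → Plane) (a b : ℝ) : ℝ :=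
  (T (a, initialMomentum T a b)).2

theorem IsTQ.apply_initialMomentum (hT : IsTQ T) (a b : ℝ) :
    T (a, initialMomentum T a b) = (b, finalMomentum T a b) :=
  Prod.ext (Function.invFun_eq (hT.surjective_fst a b)) rfl

theorem IsTQ.initialMomentum_fst (hT : IsTQ T) (z : Plane) :
    initialMomentum T z.1 (T z).1 = z.2 :=
  Function.leftInverse_invFun (hT.strictMono_fst z.1).injective z.2

theorem IsTQ.finalMomentum_fst (hT : IsTQ T) (z : Plane) :
    finalMomentum T z.1 (T z).1 = (T z).2 := by
  rw [finalMomentum, hT.initialMomentum_fst]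

theorem IsTQ.strictMono_initialMomentum (hT : IsTQ T) (a : ℝ) :
    StrictMono (initialMomentum T a) := fun b b' hbb' => by
  rwa [← (hT.strictMono_fst a).lt_iff_lt, hT.apply_initialMomentum, hT.apply_initialMomentum]

theorem IsTQ.initialMomentum_add_int (hT : IsTQ T) (a b : ℝ) (m n : ℤ) :
    initialMomentum T (a + m) (b + n) = initialMomentum T a b + n - m := by
  have hshift := hT.initialMomentum_fst ((a, initialMomentum T a b) + ((m : ℝ), ((n - m : ℤ) : ℝ)))
  rw [hT.apply_add, hT.apply_initialMomentum] at hshift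
  simpa [add_sub_assoc] using hshift

theorem IsTQ.finalMomentum_add_int (hT : IsTQ T) (a b : ℝ) (m n : ℤ) :
    finalMomentum T (a + m) (b + n) = finalMomentum T a b + n - m := by
  have hshift := hT.finalMomentum_fst ((a, initialMomentum T a b) + ((m : ℝ), ((n - m : ℤ) : ℝ)))
  rw [hT.apply_add, hT.apply_initialMomentum] at hshift
  simpa [add_sub_assoc] using hshift

theorem IsTQ.exists_lipschitzWith_initialMomentum (hT : IsTQ T) :
    ∃ K, LipschitzWith K fun p : ℝ × ℝ => initialMomentum T p.1 p.2 := by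
  obtain ⟨K, hK⟩ := hT.exists_lipschitzWith
  obtain ⟨C, hC⟩ := hT.exists_antilipschitzWith_fst
  exact ⟨_, lipschitzWith_implicit
    (fun I => LipschitzWith.prod_fst.comp (hK.comp (LipschitzWith.prodMk_right I))) hC
    fun a b => congrArg Prod.fst (hT.apply_initialMomentum a b)⟩

theorem IsTQ.exists_lipschitzWith_finalMomentum (hT : IsTQ T) :
    ∃ K, LipschitzWith K fun p : ℝ × ℝ => finalMomentum T p.1 p.2 := by
  obtain ⟨K, hK⟩ := hT.exists_lipschitzWith
  obtain ⟨L, hL⟩ := hT.exists_lipschitzWith_initialMomentum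
  exact ⟨_, LipschitzWith.prod_snd.comp (hK.comp (LipschitzWith.prod_fst.prodMk hL))⟩

theorem IsTQ.strictAnti_finalMomentum (hT : IsTQ T) (b : ℝ) :
    StrictAnti fun a => finalMomentum T a b := by
  obtain ⟨K, hK⟩ := hT.exists_lipschitzWith_finalMomentum
  have hinj : Function.Injective fun a => finalMomentum T a b := fun a a' haa' => by
    have hTaa' : T (a, initialMomentum T a b) = T (a', initialMomentum T a' b) := by
      rw [hT.apply_initialMomentum, hT.apply_initialMomentum]
      exact Prod.ext rfl haa'
    exact congrArg Prod.fst (hT.bijective.1 hTaa')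
  refine ((hK.continuous.comp (Continuous.prodMk_left b)).strictMono_of_inj hinj).resolve_left
    fun hmono => ?_
  have hshift := hT.finalMomentum_add_int 0 b 1 0
  have hlt : finalMomentum T 0 b < finalMomentum T (0 + 1) b := hmono (lt_add_one 0)
  simp only [Int.cast_one, Int.cast_zero, add_zero] at hshift
  linarith

/-- The recurrence `g xᵢ xᵢ₊₁ = h xᵢ₋₁ xᵢ` is monotone: written as `g xᵢ xᵢ₊₁ - h xᵢ₋₁ xᵢ = 0`, its
left-hand side increases with both neighbours of `xᵢ` and varies at a bounded rate. It is also
invariant under integer translations. -/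
structure IsMonotoneRecurrence (g h : ℝ → ℝ → ℝ) : Prop where
  strictMono : ∀ a, StrictMono (g a)
  strictAnti : ∀ b, StrictAnti fun a => h a b
  left_add_int : ∀ (a b : ℝ) (m n : ℤ), g (a + m) (b + n) = g a b + n - m
  right_add_int : ∀ (a b : ℝ) (m n : ℤ), h (a + m) (b + n) = h a b + n - m
  exists_lipschitzWith_left : ∃ K, LipschitzWith K fun p : ℝ × ℝ => g p.1 p.2
  exists_lipschitzWith_right : ∃ K, LipschitzWith K fun p : ℝ × ℝ => h p.1 p.2

theorem IsTQ.isMonotoneRecurrence (hT : IsTQ T) :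
    IsMonotoneRecurrence (initialMomentum T) (finalMomentum T) where
  strictMono := hT.strictMono_initialMomentum
  strictAnti := hT.strictAnti_finalMomentum
  left_add_int := hT.initialMomentum_add_int
  right_add_int := hT.finalMomentum_add_int
  exists_lipschitzWith_left := hT.exists_lipschitzWith_initialMomentum
  exists_lipschitzWith_right := hT.exists_lipschitzWith_finalMomentum

theorem IsMonotoneRecurrence.continuous_left {g h : ℝ → ℝ → ℝ} (hgh : IsMonotoneRecurrence g h) :
    Continuous fun p : ℝ × ℝ => g p.1 p.2 :=
  hgh.exists_lipschitzWith_left.choose_spec.continuous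

theorem IsMonotoneRecurrence.continuous_right {g h : ℝ → ℝ → ℝ} (hgh : IsMonotoneRecurrence g h) :
    Continuous fun p : ℝ × ℝ => h p.1 p.2 :=
  hgh.exists_lipschitzWith_right.choose_spec.continuous

end Momenta

section Exactness

/-- The part of the cylinder below the graph of `γ`. -/
def below (γ : UnitAddCircle → ℝ) : Set Cylinder := {x | x.2 < γ x.1}

theorem isOpen_below {γ : UnitAddCircle → ℝ} (hγ : Continuous γ) : IsOpen (below γ) :=
  isOpen_lt continuous_snd (hγ.comp continuous_fst)

/-- The region below a continuous graph is a copy of the cylinder: the logarithm of the distance to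
the graph is a vertical coordinate. -/
noncomputable def belowHomeomorph (γ : UnitAddCircle → ℝ) (hγ : Continuous γ) :
    below γ ≃ₜ Cylinder where
  toFun x := (x.1.1, Real.log (γ x.1.1 - x.1.2))
  invFun y := ⟨(y.1, γ y.1 - Real.exp y.2), sub_lt_self _ (Real.exp_pos y.2)⟩
  left_inv x := Subtype.ext <| by
    simp only [Real.exp_log (sub_pos.2 (Set.mem_ofPred.1 x.2)), sub_sub_cancel]
  right_inv y := by simp
  continuous_toFun := by
    have hgap : Continuous fun x : below γ => γ x.1.1 - x.1.2 := by fun_prop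
    have hlog := hgap.log fun x => (sub_pos.2 (Set.mem_ofPred.1 x.2)).ne'
    fun_prop
  continuous_invFun := by fun_prop

theorem measure_below_sdiff_lt {μ : Measure Cylinder} [μ.IsOpenPosMeasure]
    {γ γ' : UnitAddCircle → ℝ} (hγ : Continuous γ) (hγ' : Continuous γ') (hlt : ∀ x, γ x < γ' x) :
    μ (below γ \ below γ') < μ (below γ' \ below γ) := by
  have hsub : below γ ⊆ below γ' := fun x hx => lt_trans hx (hlt x.1)
  rw [Set.sdiff_eq_empty.2 hsub, measure_empty]
  have hopen : IsOpen {x : Cylinder | γ x.1 < x.2 ∧ x.2 < γ' x.1} :=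
    (isOpen_lt (hγ.comp continuous_fst) continuous_snd).inter (isOpen_below hγ')
  obtain ⟨y, hy⟩ := exists_between (hlt 0)
  exact (hopen.measure_pos μ ⟨(0, y), hy⟩).trans_le
    (measure_mono fun x hx => ⟨hx.2, fun hxγ => lt_asymm hx.1 hxγ⟩)

/-- The zero-flux condition in `IsExact`: as much `μ`-mass enters a lower end `A` of the cylinder
under `F` as leaves it. -/
def HasZeroFlux (μ : Measure Cylinder) (F : Cylinder → Cylinder) : Prop :=
  ∀ A : Set Cylinder, IsOpen A → Nonempty (A ≃ₜ Cylinder) →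
    (∃ a b : ℝ, (∀ x : Cylinder, x.2 < a → x ∈ A) ∧ (∀ x ∈ A, x.2 < b)) →
    μ ((F '' A) \ A) = μ (A \ (F '' A))

theorem HasZeroFlux.exists_eq_of_image_below_eq {μ : Measure Cylinder} [μ.IsOpenPosMeasure]
    {F : Cylinder → Cylinder} (hflux : HasZeroFlux μ F) {γ γ' : UnitAddCircle → ℝ}
    (hγ : Continuous γ) (hγ' : Continuous γ') (himage : F '' below γ = below γ') :
    ∃ x, γ x = γ' x := by
  by_contra! hne
  obtain ⟨lo, hlo⟩ := (isCompact_range hγ).bddBelow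
  obtain ⟨hi, hhi⟩ := (isCompact_range hγ).bddAbove
  have hbalance := hflux (below γ) (isOpen_below hγ) ⟨belowHomeomorph γ hγ⟩
    ⟨lo, hi, fun x hx => hx.trans_le (hlo ⟨x.1, rfl⟩),
      fun x hx => lt_of_lt_of_le hx (hhi ⟨x.1, rfl⟩)⟩
  rw [himage] at hbalance
  have hsign : (∀ x, γ x < γ' x) ∨ ∀ x, γ' x < γ x := by
    by_contra! ⟨⟨x, hx⟩, y, hy⟩
    obtain ⟨z, hz⟩ := intermediate_value_univ₂ hγ hγ' hy hx
    exact hne z hz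
  rcases hsign with hlt | hlt
  · exact (measure_below_sdiff_lt hγ hγ' hlt).ne' hbalance
  · exact (measure_below_sdiff_lt hγ' hγ hlt).ne hbalance

variable {T : Plane → Plane}

theorem toCylinder_surjective : Function.Surjective toCylinder :=
  Prod.map_surjective.2 ⟨QuotientAddGroup.mk_surjective, Function.surjective_id⟩

theorem IsTQ.image_below_lift (hT : IsTQ T) {f f' : ℝ → ℝ} (hf : Function.Periodic f 1)
    (hf' : Function.Periodic f' 1) (himage : ∀ z, (T z).2 < f' (T z).1 ↔ z.2 < f z.1) :
    cylinderMap T '' below hf.lift = below hf'.lift := by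
  apply Set.Subset.antisymm
  · rintro _ ⟨x, hx, rfl⟩
    obtain ⟨z, rfl⟩ := toCylinder_surjective x
    rw [hT.cylinderMap_toCylinder]
    exact (himage z).2 hx
  · intro y hy
    obtain ⟨w, rfl⟩ := toCylinder_surjective y
    obtain ⟨z, rfl⟩ := hT.bijective.2 w
    exact ⟨toCylinder z, (himage z).1 hy, hT.cylinderMap_toCylinder z⟩

theorem IsTQ.snd_lt_finalMomentum_iff (hT : IsTQ T) (z : Plane) :
    (T z).2 < finalMomentum T (T z).1 (T z).1 ↔ z.2 < initialMomentum T z.1 z.1 := by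
  rw [← hT.finalMomentum_fst z, (hT.strictAnti_finalMomentum _).lt_iff_gt,
    ← hT.initialMomentum_fst z, (hT.strictMono_initialMomentum _).lt_iff_lt]

theorem IsTQ.exists_fixedPoint (hT : IsTQ T) {μ : Measure Cylinder} [μ.IsOpenPosMeasure]
    (hflux : HasZeroFlux μ (cylinderMap T)) : ∃ z, T z = z := by
  have hleft : Function.Periodic (fun a => initialMomentum T a a) 1 := fun a => by
    simpa using hT.initialMomentum_add_int a a 1 1
  have hright : Function.Periodic (fun a => finalMomentum T a a) 1 := fun a => by
    simpa using hT.finalMomentum_add_int a a 1 1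
  have hdiag : Continuous fun a : ℝ => (a, a) := continuous_id.prodMk continuous_id
  obtain ⟨x, hx⟩ := hflux.exists_eq_of_image_below_eq
    (continuous_coinduced_dom.2 (hT.isMonotoneRecurrence.continuous_left.comp hdiag) :
      Continuous hleft.lift)
    (continuous_coinduced_dom.2 (hT.isMonotoneRecurrence.continuous_right.comp hdiag) :
      Continuous hright.lift)
    (hT.image_below_lift hleft hright hT.snd_lt_finalMomentum_iff)
  obtain ⟨a, rfl⟩ := QuotientAddGroup.mk_surjective x
  exact ⟨(a, initialMomentum T a a), (hT.apply_initialMomentum a a).trans (congrArg _ hx.symm)⟩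

end Exactness

section CyclicSolutions

theorem exists_forall_le_and_fiberwise_eq {α β γ : Type*} [LinearOrder γ] {f : α → β}
    (hf : Function.Surjective f) {w : α → γ} (hw : Tendsto w cofinite atTop) :
    ∃ v : β → γ, (∀ a, v (f a) ≤ w a) ∧ ∀ b, ∃ a, f a = b ∧ v b = w a := by
  have hmin (b : β) : ∃ a, f a = b ∧ ∀ a', f a' = b → w a ≤ w a' := by
    have : Nonempty {a // f a = b} := nonempty_subtype.2 (hf b)
    obtain ⟨a, ha⟩ := (hw.comp
      (Subtype.val_injective (p := (f · = b))).tendsto_cofinite).exists_forall_le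
    exact ⟨a, a.2, fun a' ha' => ha ⟨a', ha'⟩⟩
  choose a hfa hmin using hmin
  exact ⟨fun b => w (a b), fun a' => hmin _ a' rfl, fun b => ⟨a b, hfa b, rfl⟩⟩

variable {R : Type*} [AddGroupWithOne R] {N : ℕ} {g h : ℝ → ℝ → ℝ}

/-- The amount by which the sequence `u` fails to solve the recurrence
`g uᵢ uᵢ₊₁ - h uᵢ₋₁ uᵢ + eᵢ = 0` with forcing `e` at the index `i`. The indices are integers or
integers modulo `N`. -/
def defect (g h : ℝ → ℝ → ℝ) (e u : R → ℝ) (i : R) : ℝ :=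
  g (u i) (u (i + 1)) - h (u (i - 1)) (u i) + e i

theorem defect_comp_intCast (e u : R → ℝ) (i : ℤ) :
    defect g h (fun i : ℤ => e i) (fun i : ℤ => u i) i = defect g h e u i := by
  simp only [defect, Int.cast_add, Int.cast_sub, Int.cast_one]

theorem defect_neg (e u : R → ℝ) (i : R) :
    defect (fun a b => -g (-a) (-b)) (fun a b => -h (-a) (-b)) (-e) (-u) i =
      -defect g h e u i := by
  simp only [defect, Pi.neg_apply, neg_neg]
  ring

theorem defect_le_defect (hg : ∀ a, Monotone (g a)) (hh : ∀ b, Antitone fun a => h a b)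
    (e : R → ℝ) {u v : R → ℝ} (huv : u ≤ v) {i : R} (hi : u i = v i) :
    defect g h e u i ≤ defect g h e v i := by
  simp only [defect, hi]
  gcongr ?_ - ?_ + _
  · exact hg _ (huv _)
  · exact hh _ (huv _)

theorem defect_lt_defect (hg : ∀ a, StrictMono (g a)) (hh : ∀ b, Antitone fun a => h a b)
    (e : R → ℝ) {u v : R → ℝ} (huv : u ≤ v) {i : R} (hi : u i = v i)
    (hlt : u (i + 1) < v (i + 1)) : defect g h e u i < defect g h e v i := by
  have hprev : h (v (i - 1)) (v i) ≤ h (u (i - 1)) (v i) := hh _ (huv _)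
  have hnext := hg (v i) hlt
  simp only [defect, hi]
  linarith

theorem exists_strict_supersolution [NeZero N] (hg : ∀ a, StrictMono (g a))
    (hh : ∀ b, Antitone fun a => h a b) (e : ZMod N → ℝ) {w : ℤ → ℝ}
    (hw : ∀ i, defect g h (fun i : ℤ => e i) w i = 0) (hlim : Tendsto w cofinite atTop) :
    ∃ v : ZMod N → ℝ, (∀ i, defect g h e v i ≤ 0) ∧ ∃ i, defect g h e v i < 0 := by
  obtain ⟨v, hvw, hv⟩ := exists_forall_le_and_fiberwise_eq (ZMod.intCast_surjective (n := N)) hlim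
  refine ⟨v, fun r => ?_, ?_⟩
  · obtain ⟨j, rfl, hj⟩ := hv r
    rw [← hw j, ← defect_comp_intCast]
    exact defect_le_defect (fun a => (hg a).monotone) hh _ hvw hj
  · by_contra! hnonneg
    have hstep (i : ℤ) (hi : v i = w i) : v (i + 1 : ℤ) = w (i + 1) := by
      refine eq_of_le_of_not_lt (hvw _) fun hlt => (hnonneg i).not_gt ?_
      rw [← hw i, ← defect_comp_intCast]
      exact defect_lt_defect hg hh _ hvw hi hlt
    obtain ⟨j, hj₀, hj⟩ := hv 0
    rw [← hj₀] at hj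
    have htouch (m : ℕ) : v (j + m : ℤ) = w (j + m) := by
      induction m with
      | zero => simpa only [Nat.cast_zero, add_zero] using hj
      | succ m ih => simpa only [Nat.cast_succ, ← add_assoc] using hstep _ ih
    have hw' : Tendsto (fun m : ℕ => w (j + m)) atTop atTop := by
      rw [← Nat.cofinite_eq_atTop]
      exact hlim.comp ((add_right_injective j).comp Nat.cast_injective).tendsto_cofinite
    refine not_bddAbove_of_tendsto_atTop hw' ((Set.finite_range v).bddAbove.mono ?_)
    rintro _ ⟨m, rfl⟩
    exact ⟨_, htouch m⟩

theorem exists_strict_subsolution [NeZero N] (hg : ∀ a, StrictMono (g a))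
    (hh : ∀ b, Antitone fun a => h a b) (e : ZMod N → ℝ) {w : ℤ → ℝ}
    (hw : ∀ i, defect g h (fun i : ℤ => e i) w i = 0) (hlim : Tendsto w cofinite atBot) :
    ∃ v : ZMod N → ℝ, (∀ i, 0 ≤ defect g h e v i) ∧ ∃ i, 0 < defect g h e v i := by
  obtain ⟨v, hv, i, hi⟩ := exists_strict_supersolution (g := fun a b => -g (-a) (-b))
    (h := fun a b => -h (-a) (-b)) (fun a b b' hb => neg_lt_neg (hg _ (neg_lt_neg hb)))
    (fun b a a' ha => neg_le_neg (hh _ (neg_le_neg ha))) (-e)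
    (fun i => (defect_neg _ w i).trans (by rw [hw, neg_zero])) (tendsto_neg_atBot_atTop.comp hlim)
  rw [← neg_neg v] at hv hi
  simp only [defect_neg, neg_nonpos, neg_lt_zero] at hv hi
  exact ⟨-v, hv, i, hi⟩

end CyclicSolutions

section Relaxation

theorem strictMono_add_mul_of_lipschitzWith {K : NNReal} {f : ℝ → ℝ} (hf : LipschitzWith K f)
    {ε : ℝ} (hε : 0 ≤ ε) (hεK : ε * K < 1) : StrictMono fun a => a + ε * f a := fun a b hab => by
  have hlip := (abs_le.1 ((Real.dist_eq _ _).symm.trans_le (hf.dist_le_mul b a))).1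
  rw [Real.dist_eq, abs_of_pos (sub_pos.2 hab)] at hlip
  have hgain : 0 < (1 - ε * K) * (b - a) := mul_pos (sub_pos.2 hεK) (sub_pos.2 hab)
  have hloss := mul_le_mul_of_nonneg_left hlip hε
  change a + ε * f a < b + ε * f b
  linarith

theorem strongLT_iterate_of_propagates {N : ℕ} [NeZero N] {P : (ZMod N → ℝ) → ZMod N → ℝ}
    (hmono : Monotone P)
    (hP : ∀ ⦃u v⦄, u ≤ v → ∀ i, u i < v i ∨ u (i + 1) < v (i + 1) → P u i < P v i)
    {u v : ZMod N → ℝ} (huv : u < v) : StrongLT (P^[N] u) (P^[N] v) := by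
  obtain ⟨hle, i₀, hi₀⟩ := Pi.lt_def.1 huv
  have hspread (m t : ℕ) (ht : t ≤ m) : P^[m] u (i₀ - t) < P^[m] v (i₀ - t) := by
    induction m generalizing t with
    | zero => simpa [Nat.le_zero.1 ht] using hi₀
    | succ m ih =>
      rw [Function.iterate_succ_apply', Function.iterate_succ_apply']
      refine hP (hmono.iterate m hle) _ ?_
      rcases ht.lt_or_eq with ht | rfl
      · exact .inl (ih t (Nat.lt_succ_iff.1 ht))
      · right
        rw [Nat.cast_succ, ← sub_sub, sub_add_cancel]
        exact ih m le_rfl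
  intro i
  simpa using hspread N (i₀ - i).val (ZMod.val_lt _).le

variable {R : Type*} [AddGroupWithOne R] {N : ℕ} {g h : ℝ → ℝ → ℝ} {e : R → ℝ} {ε : ℝ}

/-- One step of size `ε` of the relaxation of `u` towards a solution of the recurrence. -/
def relax (g h : ℝ → ℝ → ℝ) (e : R → ℝ) (ε : ℝ) (u : R → ℝ) : R → ℝ :=
  u + ε • defect g h e u

theorem le_relax_iff (hε : 0 < ε) {u : R → ℝ} {i : R} :
    u i ≤ relax g h e ε u i ↔ 0 ≤ defect g h e u i := by
  simp [relax, hε]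

theorem relax_le_iff (hε : 0 < ε) {u : R → ℝ} {i : R} :
    relax g h e ε u i ≤ u i ↔ defect g h e u i ≤ 0 := by
  simp [relax, mul_nonpos_iff_pos_imp_nonpos, hε, hε.le]

theorem relax_eq_self_iff (hε : ε ≠ 0) {u : R → ℝ} :
    relax g h e ε u = u ↔ defect g h e u = 0 := by
  simp [relax, hε]

theorem relax_apply (u : R → ℝ) (i : R) :
    relax g h e ε u i = u i + ε * (g (u i) (u (i + 1)) - h (u (i - 1)) (u i)) + ε * e i := by
  simp only [relax, defect, Pi.add_apply, Pi.smul_apply, smul_eq_mul]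
  ring

theorem monotone_relax (hg : ∀ a, Monotone (g a)) (hh : ∀ b, Antitone fun a => h a b)
    (hε : 0 ≤ ε) (hstep : ∀ b c, Monotone fun a => a + ε * (g a b - h c a)) :
    Monotone (relax g h e ε) := fun u v huv i => by
  rw [relax_apply, relax_apply]
  gcongr ?_ + _
  refine (hstep _ _ (huv i)).trans ?_
  dsimp only
  gcongr
  · exact hg _ (huv _)
  · exact hh _ (huv _)

theorem relax_lt_relax (hg : ∀ a, StrictMono (g a)) (hh : ∀ b, Antitone fun a => h a b)
    (hε : 0 < ε) (hstep : ∀ b c, StrictMono fun a => a + ε * (g a b - h c a)) {u v : R → ℝ}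
    (huv : u ≤ v) (i : R) (hlt : u i < v i ∨ u (i + 1) < v (i + 1)) :
    relax g h e ε u i < relax g h e ε v i := by
  have hprev : h (v (i - 1)) (v i) ≤ h (u (i - 1)) (v i) := hh _ (huv _)
  rw [relax_apply, relax_apply]
  gcongr ?_ + _
  rcases hlt with hlt | hlt
  · refine (hstep (u (i + 1)) (u (i - 1)) hlt).trans_le ?_
    dsimp only
    gcongr
    exact (hg _).monotone (huv _)
  · refine ((hstep (u (i + 1)) (u (i - 1))).monotone (huv i)).trans_lt ?_
    have hnext := hg (v i) hlt
    gcongr v i + ε * ?_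
    linarith

theorem IsMonotoneRecurrence.relax_add_int (hgh : IsMonotoneRecurrence g h) (u : R → ℝ) (j : ℤ) :
    relax g h e ε (u + ((j : ℤ) : R → ℝ)) = relax g h e ε u + ((j : ℤ) : R → ℝ) := by
  ext i
  simp only [relax_apply, Pi.add_apply, Pi.intCast_apply, hgh.left_add_int, hgh.right_add_int]
  ring

theorem IsMonotoneRecurrence.continuous_relax (hgh : IsMonotoneRecurrence g h) :
    Continuous (relax g h e ε) := by
  refine continuous_pi fun i => ?_
  simp only [relax_apply]
  have hleft : Continuous fun u : R → ℝ => g (u i) (u (i + 1)) :=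
    hgh.continuous_left.comp (by fun_prop : Continuous fun u : R → ℝ => (u i, u (i + 1)))
  have hright : Continuous fun u : R → ℝ => h (u (i - 1)) (u i) :=
    hgh.continuous_right.comp (by fun_prop : Continuous fun u : R → ℝ => (u (i - 1), u i))
  exact ((continuous_apply i).add ((hleft.sub hright).const_mul ε)).add_const _

theorem IsMonotoneRecurrence.exists_strictMono_step (hgh : IsMonotoneRecurrence g h) :
    ∃ ε > 0, ∀ b c, StrictMono fun a => a + ε * (g a b - h c a) := by
  obtain ⟨K, hK⟩ := hgh.exists_lipschitzWith_left
  obtain ⟨K', hK'⟩ := hgh.exists_lipschitzWith_right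
  refine ⟨(K + K' + 1 : NNReal)⁻¹, by positivity, fun b c => strictMono_add_mul_of_lipschitzWith
    (f := fun a => g a b - h c a) (K := K * 1 + K' * 1) ?_ (by positivity) ?_⟩
  · exact (hK.comp (LipschitzWith.prodMk_right b)).sub (hK'.comp (LipschitzWith.prodMk_left c))
  · rw [mul_one, mul_one, inv_mul_lt_one₀ (by positivity)]
    exact_mod_cast lt_add_one (K + K')

theorem IsMonotoneRecurrence.isEventuallyStronglyMonotone_relax [NeZero N]
    (hgh : IsMonotoneRecurrence g h) (hε : 0 < ε)
    (hstep : ∀ b c, StrictMono fun a => a + ε * (g a b - h c a)) (e : ZMod N → ℝ) :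
    IsEventuallyStronglyMonotone (relax g h e ε) := by
  have hanti (b : ℝ) := (hgh.strictAnti b).antitone
  have hmono : Monotone (relax g h e ε) := monotone_relax (fun a => (hgh.strictMono a).monotone)
    hanti hε.le fun b c => (hstep b c).monotone
  exact ⟨hgh.continuous_relax, hmono, N, NeZero.pos N, fun u v =>
    strongLT_iterate_of_propagates hmono fun _ _ => relax_lt_relax hgh.strictMono hanti hε hstep⟩

theorem IsMonotoneRecurrence.exists_two_cyclic_solutions [NeZero N]
    (hgh : IsMonotoneRecurrence g h) {e : ZMod N → ℝ} {w w' : ℤ → ℝ}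
    (hw : ∀ i, defect g h (fun i : ℤ => e i) w i = 0) (hlim : Tendsto w cofinite atTop)
    (hw' : ∀ i, defect g h (fun i : ℤ => e i) w' i = 0) (hlim' : Tendsto w' cofinite atBot) :
    ∃ u v : ZMod N → ℝ, defect g h e u = 0 ∧ defect g h e v = 0 ∧ ∀ j : ℤ, v ≠ u + j := by
  have hanti (b : ℝ) := (hgh.strictAnti b).antitone
  obtain ⟨ε, hε, hstep⟩ := hgh.exists_strictMono_step
  obtain ⟨t, ht, i, hi⟩ := exists_strict_supersolution hgh.strictMono hanti e hw hlim
  obtain ⟨l, hl, j, hj⟩ := exists_strict_subsolution hgh.strictMono hanti e hw' hlim'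
  simp only [← relax_eq_self_iff hε.ne']
  exact (hgh.isEventuallyStronglyMonotone_relax hε hstep e).exists_two_fixedPoints
    hgh.relax_add_int
    (Pi.lt_def.2 ⟨fun r => (le_relax_iff hε).2 (hl r), j,
      (lt_iff_lt_of_le_iff_le (relax_le_iff hε)).2 hj⟩)
    (Pi.lt_def.2 ⟨fun r => (relax_le_iff hε).2 (ht r), i,
      (lt_iff_lt_of_le_iff_le (le_relax_iff hε)).2 hi⟩)

end Relaxation

section QuadraticGrowth

theorem tendsto_add_mul_self_cofinite {α : ℝ} (hα : 0 < α) (γ : ℝ) :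
    Tendsto (fun i : ℤ => (α * i + γ) * i) cofinite atTop := by
  rw [Int.cofinite_eq, tendsto_sup]
  have hbot : Tendsto ((↑) : ℤ → ℝ) atBot atBot := tendsto_intCast_atBot_iff.2 tendsto_id
  have htop : Tendsto ((↑) : ℤ → ℝ) atTop atTop := tendsto_intCast_atTop_atTop
  exact ⟨(tendsto_atBot_add_const_right _ _ (hbot.const_mul_atBot hα)).atBot_mul_atBot₀ hbot,
    (tendsto_atTop_add_const_right _ _ (htop.const_mul_atTop hα)).atTop_mul_atTop₀ htop⟩

variable {w : ℤ → ℝ} {n : ℕ} {A β : ℝ}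

theorem tendsto_atTop_of_quadratic_growth (hn : 0 < n) (hβ : 0 < β)
    (hw : ∀ i : ℤ, w (i + n) = w i + A + β * i) : Tendsto w cofinite atTop := by
  have hn' : (n : ℝ) ≠ 0 := by exact_mod_cast hn.ne'
  obtain ⟨α, hα⟩ : ∃ α, α = β / (2 * n) := ⟨_, rfl⟩
  obtain ⟨γ, hγ⟩ : ∃ γ, γ = A / n - α * n := ⟨_, rfl⟩
  -- `α` and `γ` are chosen so that the quadratic polynomial has the same increments as `w`.
  have hper : Function.Periodic (fun i : ℤ => w i - (α * i + γ) * i) n := fun i => by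
    simp only [hw, hγ, hα]
    push_cast
    field_simp
    ring
  obtain ⟨m, hm⟩ : BddBelow (Set.range fun i : ℤ => w i - (α * i + γ) * i) := by
    rw [← hper.image_Icc (by exact_mod_cast hn) 0]
    exact ((Set.finite_Icc _ _).image _).bddBelow
  refine tendsto_atTop_mono (fun i => ?_) (tendsto_atTop_add_const_right _ m
    (tendsto_add_mul_self_cofinite (hα ▸ by positivity : 0 < α) γ))
  linarith [hm ⟨i, rfl⟩]

theorem tendsto_atBot_of_quadratic_growth (hn : 0 < n) (hβ : β < 0)
    (hw : ∀ i : ℤ, w (i + n) = w i + A + β * i) : Tendsto w cofinite atBot := by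
  have hneg := tendsto_atTop_of_quadratic_growth (w := fun i => -w i) hn (A := -A)
    (neg_pos.2 hβ) fun i => by rw [hw]; ring
  exact tendsto_neg_atTop_iff.1 hneg

theorem exists_apply_add_mul_eq (hw : ∀ i : ℤ, w (i + n) = w i + A + β * i) (m : ℕ) :
    ∃ A' : ℝ, ∀ i : ℤ, w (i + (m * n : ℕ)) = w i + A' + m * β * i := by
  induction m with
  | zero => exact ⟨0, fun i => by simp⟩
  | succ m ih =>
    obtain ⟨A', hA'⟩ := ih
    refine ⟨A' + A + β * (m * n : ℕ), fun i => ?_⟩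
    rw [Nat.succ_mul, Nat.cast_add, ← add_assoc, hw, hA']
    push_cast
    ring

end QuadraticGrowth

section BrokenLine

/-- The convex piecewise linear integer sequence with slope `⌊i / N⌋` between `i` and `i + 1`; it is
used to shift orbits of `T` by integers. -/
def brokenLine (N : ℕ) (i : ℤ) : ℤ := i / N * i - N * (i / N * (i / N + 1) / 2)

theorem triangle_succ (q : ℤ) : (q + 1) * (q + 1 + 1) / 2 = q * (q + 1) / 2 + (q + 1) := by
  rw [← Int.add_mul_ediv_right _ _ two_ne_zero]
  ring_nf

theorem ediv_sub_ediv_sub_one {N : ℤ} (hN : 0 < N) (i : ℤ) :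
    i / N - (i - 1) / N = if N ∣ i then 1 else 0 := by
  split_ifs with hdvd
  · obtain ⟨q, rfl⟩ := hdvd
    have hprev : (N * q - 1) / N = q - 1 := by
      rw [Int.ediv_eq_iff_of_pos hN]
      constructor <;> linarith
    rw [hprev, Int.mul_ediv_cancel_left _ hN.ne', sub_sub_cancel]
  · have hprev : (i - 1) / N = i / N := by
      have hdiv := Int.emod_add_mul_ediv i N
      have hlt := Int.emod_lt_of_pos i hN
      have hpos := (Int.emod_pos_of_not_dvd hdvd).resolve_left hN.ne'
      rw [Int.ediv_eq_iff_of_pos hN]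
      constructor <;> linarith
    rw [hprev, sub_self]

variable (N : ℕ)

theorem brokenLine_zero : brokenLine N 0 = 0 := by simp [brokenLine]

variable [NeZero N]

theorem brokenLine_add_one (i : ℤ) : brokenLine N (i + 1) = brokenLine N i + i / N := by
  have hN : (0 : ℤ) < N := by exact_mod_cast NeZero.pos N
  have hslope := ediv_sub_ediv_sub_one hN (i + 1)
  rw [add_sub_cancel_right] at hslope
  split_ifs at hslope with hdvd
  · have hdiv := Int.mul_ediv_cancel' hdvd
    rw [sub_eq_iff_eq_add'] at hslope
    rw [brokenLine, brokenLine, hslope, triangle_succ]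
    rw [hslope] at hdiv
    linear_combination -hdiv
  · rw [brokenLine, brokenLine, sub_eq_zero.1 hslope]
    ring

theorem brokenLine_add_self (i : ℤ) : brokenLine N (i + N) = brokenLine N i + i := by
  have hN : (N : ℤ) ≠ 0 := by exact_mod_cast NeZero.ne N
  rw [brokenLine, brokenLine, Int.add_ediv_of_dvd_right dvd_rfl, Int.ediv_self hN, triangle_succ]
  ring

theorem brokenLine_second_difference (i : ℤ) :
    brokenLine N (i + 1) - 2 * brokenLine N i + brokenLine N (i - 1) =
      if (i : ZMod N) = 0 then 1 else 0 := by
  have hprev := brokenLine_add_one N (i - 1)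
  rw [sub_add_cancel] at hprev
  simp only [ZMod.intCast_zmod_eq_zero_iff_dvd]
  rw [← ediv_sub_ediv_sub_one (by exact_mod_cast NeZero.pos N), brokenLine_add_one]
  linarith

end BrokenLine

section OrbitSequences

variable {g h : ℝ → ℝ → ℝ} {T : Plane → Plane}

theorem IsMonotoneRecurrence.defect_add_mul_brokenLine {N : ℕ} [NeZero N]
    (hgh : IsMonotoneRecurrence g h) (e x : ℤ → ℝ) (k : ℤ) :
    defect g h e (fun i => x i + (k * brokenLine N i : ℤ)) =
      defect g h (fun i => e i + (Pi.single 0 (k : ℝ) : ZMod N → ℝ) i) x := by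
  ext i
  have hsecond : k * (brokenLine N (i + 1) - 2 * brokenLine N i + brokenLine N (i - 1)) =
      if (i : ZMod N) = 0 then k else 0 := by
    rw [brokenLine_second_difference, mul_ite, mul_one, mul_zero]
  have hsecond' := congrArg (Int.cast : ℤ → ℝ) hsecond
  simp only [defect, hgh.left_add_int, hgh.right_add_int, Pi.single_apply]
  push_cast at hsecond' ⊢
  linear_combination hsecond'

theorem IsTQ.iterate_add (hT : IsTQ T) (z : Plane) (m n : ℤ) (j : ℕ) :
    T^[j] (z + ((m : ℝ), (n : ℝ))) = T^[j] z + ((m : ℝ) + j * n, (n : ℝ)) := by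
  induction j with
  | zero => simp
  | succ j ih =>
    have hstep := hT.apply_add (T^[j] z) (m + j * n) n
    push_cast at hstep
    rw [Function.iterate_succ_apply', ih, hstep, Function.iterate_succ_apply']
    push_cast
    ring_nf

/-- `T` as a permutation of the plane, so that backward orbits can be written as powers. -/
noncomputable def IsTQ.perm (hT : IsTQ T) : Equiv.Perm Plane :=
  Equiv.ofBijective T hT.bijective

theorem IsTQ.perm_apply (hT : IsTQ T) (z : Plane) : hT.perm z = T z := rfl

theorem IsTQ.perm_zpow_add_one_apply (hT : IsTQ T) (z : Plane) (i : ℤ) :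
    (hT.perm ^ (i + 1)) z = T ((hT.perm ^ i) z) := by
  rw [add_comm, zpow_one_add, Equiv.Perm.mul_apply, perm_apply]

theorem IsTQ.perm_zpow_add (hT : IsTQ T) (z : Plane) (m n i : ℤ) :
    (hT.perm ^ i) (z + ((m : ℝ), (n : ℝ))) = (hT.perm ^ i) z + ((m : ℝ) + i * n, (n : ℝ)) := by
  induction i using Int.induction_on with
  | zero => simp
  | succ i ih =>
    have hstep := hT.apply_add ((hT.perm ^ (i : ℤ)) z) (m + i * n) n
    push_cast at hstep ih ⊢
    rw [hT.perm_zpow_add_one_apply, hT.perm_zpow_add_one_apply, ih, hstep]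
    ring_nf
  | pred i ih =>
    apply hT.bijective.1
    have hstep := hT.apply_add ((hT.perm ^ (-(i : ℤ) - 1)) z) (m + (-i - 1) * n) n
    push_cast at hstep ih ⊢
    rw [← hT.perm_zpow_add_one_apply, hstep, ← hT.perm_zpow_add_one_apply, sub_add_cancel, ih]
    ring_nf

theorem IsTQ.defect_orbit (hT : IsTQ T) (z : Plane) :
    defect (initialMomentum T) (finalMomentum T) 0 (fun i : ℤ => ((hT.perm ^ i) z).1) = 0 := by
  ext i
  have hleft := hT.initialMomentum_fst ((hT.perm ^ i) z)
  have hright := hT.finalMomentum_fst ((hT.perm ^ (i - 1)) z)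
  rw [← hT.perm_zpow_add_one_apply] at hleft hright
  rw [sub_add_cancel] at hright
  simp only [defect, hleft, hright, sub_self, Pi.zero_apply, add_zero]

theorem IsTQ.iterate_of_defect_eq_zero (hT : IsTQ T) {x : ℤ → ℝ}
    (hx : defect (initialMomentum T) (finalMomentum T) 0 x = 0) (j : ℕ) :
    T^[j] (x 0, initialMomentum T (x 0) (x 1)) =
      (x j, initialMomentum T (x j) (x (j + 1))) := by
  induction j with
  | zero => simp
  | succ j ih =>
    have hdefect := congrFun hx (j + 1)
    simp only [defect, Pi.zero_apply, add_zero, add_sub_cancel_right, sub_eq_zero] at hdefect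
    rw [Function.iterate_succ_apply', ih, hT.apply_initialMomentum, Nat.cast_succ, hdefect]

theorem IsTQ.exists_orbit_sequence (hT : IsTQ T) {z : Plane} {n : ℕ} {a b : ℤ}
    (hz : T^[n] z = z + ((a : ℝ), (b : ℝ))) :
    ∃ x : ℤ → ℝ, defect (initialMomentum T) (finalMomentum T) 0 x = 0 ∧
      ∀ i : ℤ, x (i + n) = x i + a + b * i := by
  refine ⟨_, hT.defect_orbit z, fun i => ?_⟩
  have hpow : (hT.perm ^ (n : ℤ)) z = z + ((a : ℝ), (b : ℝ)) := by
    rw [zpow_natCast, ← Equiv.Perm.iterate_eq_pow]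
    exact hz
  rw [zpow_add, Equiv.Perm.mul_apply, hpow, perm_zpow_add, Prod.fst_add]
  ring

theorem IsTQ.exists_forced_solution (hT : IsTQ T) {z : Plane} {n : ℕ} {a b : ℤ}
    (hz : T^[n] z = z + ((a : ℝ), (b : ℝ))) (N : ℕ) [NeZero N] (k : ℤ) :
    ∃ (w : ℤ → ℝ) (A : ℝ),
      defect (initialMomentum T) (finalMomentum T)
        (fun i : ℤ => (Pi.single 0 (k : ℝ) : ZMod N → ℝ) i) w = 0 ∧
      ∀ i : ℤ, w (i + (N * n : ℕ)) = w i + A + ((N : ℝ) * b - n * k) * i := by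
  obtain ⟨x, hx, hxn⟩ := hT.exists_orbit_sequence hz
  obtain ⟨A, hA⟩ := exists_apply_add_mul_eq hxn N
  obtain ⟨B, hB⟩ := exists_apply_add_mul_eq (w := fun i => (brokenLine N i : ℝ)) (A := 0) (β := 1)
    (n := N) (fun i => by rw [brokenLine_add_self]; push_cast; ring) n
  refine ⟨fun i => x i + ((-k) * brokenLine N i : ℤ), A - k * B, ?_, fun i => ?_⟩
  · rw [hT.isMonotoneRecurrence.defect_add_mul_brokenLine, ← hx]
    congr
    ext i
    simp [Pi.single_neg]
  · have hBi := hB i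
    rw [mul_comm n N] at hBi
    simp only [hA]
    push_cast at hBi ⊢
    rw [hBi]
    ring

theorem IsTQ.exists_orbit_of_cyclic_solution (hT : IsTQ T) {N : ℕ} [NeZero N] {k : ℤ}
    {u : ZMod N → ℝ}
    (hu : defect (initialMomentum T) (finalMomentum T) (Pi.single 0 (k : ℝ)) u = 0) :
    ∃ z, T^[N] z = z + (((0 : ℤ) : ℝ), (k : ℝ)) ∧
      ∀ j : ℕ, (T^[j] z).1 = u j + (k * brokenLine N j : ℤ) := by
  have hN := brokenLine_add_self N 0
  have hN' := brokenLine_add_self N 1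
  have hone := brokenLine_add_one N 0
  simp only [brokenLine_zero, zero_add, Int.zero_ediv] at hN hN' hone
  have hx : defect (initialMomentum T) (finalMomentum T) 0
      (fun i : ℤ => u i + (k * brokenLine N i : ℤ)) = 0 := by
    rw [hT.isMonotoneRecurrence.defect_add_mul_brokenLine]
    ext i
    simpa only [Pi.zero_apply, zero_add, defect_comp_intCast] using congrFun hu i
  have hiterate := hT.iterate_of_defect_eq_zero hx
  simp only [Int.cast_zero, Int.cast_one, brokenLine_zero, hone, mul_zero, add_zero] at hiterate
  refine ⟨_, ?_, fun j => by rw [hiterate, Int.cast_natCast]⟩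
  have hshift := hT.initialMomentum_add_int (u 0) (u 1) 0 k
  simp only [Int.cast_zero, add_zero, sub_zero] at hshift
  simp [hiterate, hN, hN', hone, add_comm (N : ℤ) 1, hshift]

end OrbitSequences

section TorusOrbits

theorem coe_eq_coe_iff_exists_add_int {s t : ℝ} :
    (s : UnitAddCircle) = t ↔ ∃ m : ℤ, s = t + m := by
  rw [← sub_eq_zero, ← AddCircle.coe_sub, AddCircle.coe_eq_zero_iff]
  simp only [zsmul_eq_mul, mul_one, eq_comm (b := s - t), sub_eq_iff_eq_add']

theorem toTorus_eq_iff {z w : Plane} :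
    toTorus z = toTorus w ↔ ∃ m n : ℤ, z = w + ((m : ℝ), (n : ℝ)) := by
  simp only [toTorus, Prod.ext_iff, Prod.fst_add, Prod.snd_add, coe_eq_coe_iff_exists_add_int,
    exists_and_left, exists_and_right]

theorem toTorus_surjective : Function.Surjective toTorus :=
  Prod.map_surjective.2 ⟨QuotientAddGroup.mk_surjective, QuotientAddGroup.mk_surjective⟩

theorem tendsto_atTop_or_atBot_of_tendsto_sub_div {y : ℕ → ℝ} {c ω : ℝ} (hω : ω ≠ 0)
    (hy : Tendsto (fun m : ℕ => (y m - c) / m) atTop (𝓝 ω)) :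
    Tendsto y atTop atTop ∨ Tendsto y atTop atBot := by
  have heq : (fun m : ℕ => (y m - c) / m * m + c) =ᶠ[atTop] y := by
    filter_upwards [eventually_ne_atTop 0] with m hm
    rw [div_mul_cancel₀ _ (Nat.cast_ne_zero.2 hm), sub_add_cancel]
  rw [← tendsto_congr' heq, ← tendsto_congr' heq]
  exact hω.gt_or_lt.imp
    (fun hpos => tendsto_atTop_add_const_right _ _
      (hy.pos_mul_atTop hpos tendsto_natCast_atTop_atTop))
    (fun hneg => tendsto_atBot_add_const_right _ _
      (hy.neg_mul_atTop hneg tendsto_natCast_atTop_atTop))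

variable {T : Plane → Plane} {z z' : Plane} {n : ℕ} {a b : ℤ}

theorem IsTQ.exists_abs_vertical_deviation_le (hT : IsTQ T) (hn : 0 < n)
    (hz : T^[n] z = z + ((a : ℝ), (b : ℝ))) :
    ∃ M, ∀ m : ℕ, |(T^[m] z).2 - z.2 - m * ((b : ℝ) / n)| ≤ M := by
  have hn' : (n : ℝ) ≠ 0 := Nat.cast_ne_zero.2 hn.ne'
  have hper : Function.Periodic (fun m => |(T^[m] z).2 - z.2 - m * ((b : ℝ) / n)|) n := fun m => by
    simp only [Function.iterate_add_apply, hz, hT.iterate_add, Prod.snd_add]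
    push_cast
    field_simp
    ring_nf
  obtain ⟨M, hM⟩ := ((Set.finite_Iio n).image
    fun m : ℕ => |(T^[m] z).2 - z.2 - m * ((b : ℝ) / n)|).bddAbove
  exact ⟨M, fun m => (hper.map_mod_nat m).symm.trans_le (hM ⟨m % n, Nat.mod_lt _ hn, rfl⟩)⟩

theorem IsTQ.tendsto_vertical_speed (hT : IsTQ T) (hn : 0 < n)
    (hz : T^[n] z = z + ((a : ℝ), (b : ℝ))) :
    Tendsto (fun m : ℕ => ((T^[m] z).2 - z.2) / (m : ℝ)) atTop (𝓝 ((b : ℝ) / n)) := by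
  obtain ⟨M, hM⟩ := hT.exists_abs_vertical_deviation_le hn hz
  rw [tendsto_iff_norm_sub_tendsto_zero]
  refine squeeze_zero' (Eventually.of_forall fun _ => norm_nonneg _) ?_
    (tendsto_const_div_atTop_nhds_zero_nat M)
  filter_upwards [eventually_gt_atTop 0] with m hm
  have hm' : (0 : ℝ) < m := Nat.cast_pos.2 hm
  rw [Real.norm_eq_abs, div_sub' hm'.ne', abs_div, abs_of_pos hm']
  exact div_le_div_of_nonneg_right (hM m) hm'.le

theorem IsTQ.iterate_torusMap (hT : IsTQ T) (z : Plane) (m : ℕ) :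
    (torusMap T)^[m] (toTorus z) = toTorus (T^[m] z) :=
  (Function.Semiconj.iterate_right (fun w => (hT.torusMap_toTorus w).symm) m z).symm

/-- The orbit on the torus, under the map induced by `T`, of the projection of a point of the
plane. -/
def torusOrbit (T : Plane → Plane) (z : Plane) : Set Torus :=
  Set.range fun m : ℕ => (torusMap T)^[m] (toTorus z)

theorem IsTQ.toTorus_mem_torusOrbit_iff (hT : IsTQ T) :
    toTorus z' ∈ torusOrbit T z ↔ ∃ (m : ℕ) (p q : ℤ), z' = T^[m] z + ((p : ℝ), (q : ℝ)) := by
  simp only [torusOrbit, Set.mem_range, hT.iterate_torusMap, ← toTorus_eq_iff, eq_comm]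

theorem IsTQ.iterate_iterate_add (hT : IsTQ T) (hz : T^[n] z = z + ((a : ℝ), (b : ℝ))) (m : ℕ)
    (p q : ℤ) :
    T^[n] (T^[m] z + ((p : ℝ), (q : ℝ))) =
      T^[m] z + ((p : ℝ), (q : ℝ)) + (((a + m * b + n * q : ℤ) : ℝ), (b : ℝ)) := by
  rw [hT.iterate_add, ← Function.iterate_add_apply, add_comm n m,
    Function.iterate_add_apply, hz, hT.iterate_add]
  push_cast
  ext <;> simp only [Prod.fst_add, Prod.snd_add] <;> ring

theorem IsTQ.isPeriodicOrbit_torusOrbit (hT : IsTQ T) (hn : 0 < n)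
    (hz : T^[n] z = z + ((a : ℝ), (b : ℝ))) : IsPeriodicOrbit (torusMap T) (torusOrbit T z) := by
  refine ⟨toTorus z, ⟨n, hn, ?_⟩, rfl⟩
  rw [hT.iterate_torusMap, hz, toTorus_eq_iff]
  exact ⟨a, b, rfl⟩

theorem IsTQ.hasVerticalRotationNumber_torusOrbit (hT : IsTQ T) (hn : 0 < n) (hb : b ≠ 0)
    (hz : T^[n] z = z + ((a : ℝ), (b : ℝ))) :
    HasVerticalRotationNumber T (torusOrbit T z) ((b : ℝ) / n) := by
  intro z' hz'
  obtain ⟨m, p, q, rfl⟩ := hT.toTorus_mem_torusOrbit_iff.1 hz'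
  have hspeed := hT.tendsto_vertical_speed hn (hT.iterate_iterate_add hz m p q)
  have hω : (b : ℝ) / n ≠ 0 := div_ne_zero (Int.cast_ne_zero.2 hb) (Nat.cast_ne_zero.2 hn.ne')
  exact ⟨tendsto_atTop_or_atBot_of_tendsto_sub_div hω hspeed, hspeed⟩

theorem IsTQ.exists_iterate_mul (hT : IsTQ T) (hz : T^[n] z = z + ((a : ℝ), (b : ℝ))) (t : ℕ) :
    ∃ r : ℤ, T^[n * t] z = z + ((r : ℝ), ((t * b : ℤ) : ℝ)) := by
  induction t with
  | zero => exact ⟨0, by simp⟩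
  | succ t ih =>
    obtain ⟨r, hr⟩ := ih
    refine ⟨a + (r + n * (t * b)), ?_⟩
    rw [Nat.mul_succ, add_comm, Function.iterate_add_apply, hr, hT.iterate_add, hz]
    push_cast
    ext <;> simp only [Prod.fst_add, Prod.snd_add] <;> ring

theorem IsTQ.eq_add_of_mem_torusOrbit (hT : IsTQ T) (hn : 0 < n) (hcop : IsCoprime (n : ℤ) b)
    (hz : T^[n] z = z + ((a : ℝ), (b : ℝ))) (hz' : T^[n] z' = z' + ((a : ℝ), (b : ℝ)))
    (hmem : toTorus z' ∈ torusOrbit T z) : ∃ r : ℤ, z' = z + ((r : ℝ), ((0 : ℤ) : ℝ)) := by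
  obtain ⟨m, p, q, rfl⟩ := hT.toTorus_mem_torusOrbit_iff.1 hmem
  rw [hT.iterate_iterate_add hz, add_right_inj] at hz'
  have hmq : a + m * b + n * q = a := Int.cast_injective (α := ℝ) (congrArg Prod.fst hz')
  -- The vertical translation `q` is a multiple of `b`, so `p` and `q` undo a power of `T^[n]`.
  have hdvd : (n : ℤ) ∣ m := hcop.dvd_of_dvd_mul_right ⟨-q, by linarith⟩
  obtain ⟨t, rfl⟩ : n ∣ m := by exact_mod_cast hdvd
  obtain ⟨r, hr⟩ := hT.exists_iterate_mul hz t
  have hq : t * b + q = 0 := by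
    have hmul : (n : ℤ) * (t * b + q) = 0 := by
      push_cast at hmq
      linarith
    exact (mul_eq_zero.1 hmul).resolve_left (by exact_mod_cast hn.ne')
  refine ⟨r + p, ?_⟩
  rw [hr, ← hq]
  push_cast
  ext <;> simp only [Prod.fst_add, Prod.snd_add] <;> ring

theorem IsTQ.exists_lift_of_isPeriodicOrbit (hT : IsTQ T) {O : Set Torus} {ω : ℝ}
    (hO : IsPeriodicOrbit (torusMap T) O) (hω : HasVerticalRotationNumber T O ω) :
    ∃ (z : Plane) (n : ℕ) (a b : ℤ), 0 < n ∧ T^[n] z = z + ((a : ℝ), (b : ℝ)) ∧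
      ω = (b : ℝ) / n := by
  obtain ⟨x, ⟨n, hn, hx⟩, rfl⟩ := hO
  obtain ⟨z, rfl⟩ := toTorus_surjective x
  rw [hT.iterate_torusMap] at hx
  obtain ⟨a, b, hab⟩ := toTorus_eq_iff.1 hx
  exact ⟨z, n, a, b, hn, hab, tendsto_nhds_unique (hω z ⟨0, rfl⟩).2
    (hT.tendsto_vertical_speed hn hab)⟩

end TorusOrbits

section TwoOrbits

variable {T : Plane → Plane}

theorem IsTQ.exists_two_cyclic_solutions (hT : IsTQ T) {N : ℕ} [NeZero N] {k : ℤ} {z z' : Plane}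
    {n n' : ℕ} (hn : 0 < n) (hn' : 0 < n') {a b a' b' : ℤ}
    (hz : T^[n] z = z + ((a : ℝ), (b : ℝ))) (hz' : T^[n'] z' = z' + ((a' : ℝ), (b' : ℝ)))
    (hgt : (k : ℝ) / N < b / n) (hlt : (b' : ℝ) / n' < k / N) :
    ∃ u v : ZMod N → ℝ,
      defect (initialMomentum T) (finalMomentum T) (Pi.single 0 (k : ℝ)) u = 0 ∧
      defect (initialMomentum T) (finalMomentum T) (Pi.single 0 (k : ℝ)) v = 0 ∧
      ∀ j : ℤ, v ≠ u + j := by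
  have hN : 0 < N := NeZero.pos N
  obtain ⟨w, A, hw, hwN⟩ := hT.exists_forced_solution hz N k
  obtain ⟨w', A', hw', hwN'⟩ := hT.exists_forced_solution hz' N k
  rw [div_lt_div_iff₀ (by positivity) (by positivity)] at hgt hlt
  exact hT.isMonotoneRecurrence.exists_two_cyclic_solutions (congrFun hw)
    (tendsto_atTop_of_quadratic_growth (Nat.mul_pos hN hn) (by linarith) hwN) (congrFun hw')
    (tendsto_atBot_of_quadratic_growth (Nat.mul_pos hN hn') (by linarith) hwN')

theorem IsTQ.exists_two_periodic_orbits (hT : IsTQ T) {q : ℚ} (hq : q ≠ 0) {z z' : Plane}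
    {n n' : ℕ} (hn : 0 < n) (hn' : 0 < n') {a b a' b' : ℤ}
    (hz : T^[n] z = z + ((a : ℝ), (b : ℝ))) (hz' : T^[n'] z' = z' + ((a' : ℝ), (b' : ℝ)))
    (hgt : (q : ℝ) < b / n) (hlt : (b' : ℝ) / n' < q) :
    ∃ O₁ O₂ : Set Torus, O₁ ≠ O₂ ∧
      (IsPeriodicOrbit (torusMap T) O₁ ∧ HasVerticalRotationNumber T O₁ (q : ℝ)) ∧
      (IsPeriodicOrbit (torusMap T) O₂ ∧ HasVerticalRotationNumber T O₂ (q : ℝ)) := by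
  have : NeZero q.den := ⟨q.den_nz⟩
  have hnum : q.num ≠ 0 := Rat.num_ne_zero.2 hq
  have hcop : IsCoprime (q.den : ℤ) q.num := Int.isCoprime_iff_gcd_eq_one.2 q.reduced.symm
  rw [Rat.cast_def] at hgt hlt ⊢
  obtain ⟨u, v, hu, hv, huv⟩ := hT.exists_two_cyclic_solutions hn hn' hz hz' hgt hlt
  obtain ⟨x, hx, hxu⟩ := hT.exists_orbit_of_cyclic_solution hu
  obtain ⟨y, hy, hyv⟩ := hT.exists_orbit_of_cyclic_solution hv
  refine ⟨torusOrbit T x, torusOrbit T y, fun heq => ?_,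
    ⟨hT.isPeriodicOrbit_torusOrbit q.den_pos hx,
      hT.hasVerticalRotationNumber_torusOrbit q.den_pos hnum hx⟩,
    hT.isPeriodicOrbit_torusOrbit q.den_pos hy,
    hT.hasVerticalRotationNumber_torusOrbit q.den_pos hnum hy⟩
  obtain ⟨r, rfl⟩ := hT.eq_add_of_mem_torusOrbit q.den_pos hcop hx hy (heq ▸ ⟨0, rfl⟩)
  refine huv r (funext fun i => ?_)
  have hi := hyv i.val
  rw [hT.iterate_add, Prod.fst_add, hxu, ZMod.natCast_zmod_val, Int.cast_zero, mul_zero,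
    add_zero, add_right_comm] at hi
  exact (add_right_cancel hi).symm

end TwoOrbits

end TwistMap

theorem mainTheorem2_general {T : TwistMap.Plane → TwistMap.Plane} (hT : TwistMap.IsTQ T)
    {μ : Measure TwistMap.Cylinder} [μ.IsOpenPosMeasure]
    (hflux : TwistMap.HasZeroFlux μ (TwistMap.cylinderMap T)) {ω : ℝ}
    (hper : ∃ O : Set TwistMap.Torus, TwistMap.IsPeriodicOrbit (TwistMap.torusMap T) O ∧
      TwistMap.HasVerticalRotationNumber T O ω)
    {q : ℚ} (hlt : |(q : ℝ)| < |ω|) (hsign : 0 < ω * q) :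
    ∃ O₁ O₂ : Set TwistMap.Torus, O₁ ≠ O₂ ∧
      (TwistMap.IsPeriodicOrbit (TwistMap.torusMap T) O₁ ∧
        TwistMap.HasVerticalRotationNumber T O₁ (q : ℝ)) ∧
      (TwistMap.IsPeriodicOrbit (TwistMap.torusMap T) O₂ ∧
        TwistMap.HasVerticalRotationNumber T O₂ (q : ℝ)) := by
  obtain ⟨O, hO, hω⟩ := hper
  obtain ⟨z, n, a, b, hn, hz, rfl⟩ := hT.exists_lift_of_isPeriodicOrbit hO hω
  obtain ⟨z₀, hz₀⟩ := hT.exists_fixedPoint hflux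
  have hfix : T^[1] z₀ = z₀ + (((0 : ℤ) : ℝ), ((0 : ℤ) : ℝ)) := by simp [hz₀]
  have hq : q ≠ 0 := by
    rintro rfl
    simp at hsign
  rcases pos_and_pos_or_neg_and_neg_of_mul_pos hsign with ⟨hωpos, hqpos⟩ | ⟨hωneg, hqneg⟩
  · rw [abs_of_pos hqpos, abs_of_pos hωpos] at hlt
    exact hT.exists_two_periodic_orbits hq hn one_pos hz hfix hlt (by simpa using hqpos)
  · rw [abs_of_neg hqneg, abs_of_neg hωneg, neg_lt_neg_iff] at hlt
    exact hT.exists_two_periodic_orbits hq one_pos hn hfix hz (by simpa using hqneg) hlt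

theorem mainTheorem2 (T : TwistMap.Plane → TwistMap.Plane) (hT : TwistMap.IsTQ T)
    (μ : MeasureTheory.Measure TwistMap.Cylinder)
    (hμ : TwistMap.IsExact μ (TwistMap.cylinderMap T))
    (k : ℤ) (N : ℕ) (hN : 0 < N)
    (hper : ∃ O : Set TwistMap.Torus, TwistMap.IsPeriodicOrbit (TwistMap.torusMap T) O ∧
      TwistMap.HasVerticalRotationNumber T O ((k : ℝ) / (N : ℝ)))
    (k' : ℤ) (N' : ℕ) (hk' : k' ≠ 0) (hN' : 0 < N')
    (hlt : |(k' : ℝ) / (N' : ℝ)| < |(k : ℝ) / (N : ℝ)|) (hsign : 0 < k * k') :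
    ∃ O₁ O₂ : Set TwistMap.Torus, O₁ ≠ O₂ ∧
      (TwistMap.IsPeriodicOrbit (TwistMap.torusMap T) O₁ ∧
        TwistMap.HasVerticalRotationNumber T O₁ ((k' : ℝ) / (N' : ℝ))) ∧
      (TwistMap.IsPeriodicOrbit (TwistMap.torusMap T) O₂ ∧
        TwistMap.HasVerticalRotationNumber T O₂ ((k' : ℝ) / (N' : ℝ))) := by
  have : μ.IsOpenPosMeasure := ⟨fun U hU hne => (hμ.pos U hU hne).ne'⟩
  have hsign' : (0 : ℝ) < k / N * ((k' / N' : ℚ) : ℝ) := by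
    push_cast
    rw [div_mul_div_comm]
    exact div_pos (by exact_mod_cast hsign) (by positivity)
  simpa using mainTheorem2_general hT hμ.flux hper (by simpa using hlt) hsign'
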